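/- **Setting.** Let $\mathcal X$ be a finite set, $p_X$ a probability distribution on $\mathcal X$, and $\{\rho_B^x\}_{x\in\mathcal X}$ density operators on a finite-dimensional Hilbert space $\mathcal H_B$; put $\rho_{XB}=\sum_x p_X(x)|x\rangle\langle x|\otimes\rho_B^x$, and let $\mathcal S(\mathcal H_B)$ be the set of density operators on $\mathcal H_B$. For $\alpha\in[1,\infty]$ let $D_\alpha$ and $H_\alpha$ be the classical Rényi divergence and Rényi entropy (the cases $\alpha=1,\infty$ being the usual limits), and for positive semidefinite $\rho,\sigma$ define the measured Rényi divergence $$D_\alpha^{\mathbb M}(\rho\|\sigma)=\sup_{\{E_i\}}D_\alpha\big((\operatorname{Tr}[\rho E_i])_i\,\big\|\,(\operatorname{Tr}[\sigma E_i])_i\big),$$ where the supremum is over POVMs with finitely many outcomes. For a c-q state $\rho_{XB}$ let $$I_\alpha^{\mathbb M}(X:B)_\rho=\inf_{\sigma_B\in\mathcal S(\mathcal H_B)}D_\alpha^{\mathbb M}(\rho_{XB}\|\rho_X\otimes\sigma_B),\qquad I_\alpha^{\mathrm A,\mathbb M}(X:B)_\rho=H_\alpha(X)_p+\inf_{\sigma_B\in\mathcal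 S(\mathcal H_B)}D_\alpha^{\mathbb M}(\rho_{XB}\|\mathbb 1_X\otimes\sigma_B).$$ For a c-q channel $\mathscr N_{\mathcal Y\to B}:y\mapsto\rho_B^y$ let $C_\alpha^{\mathbb M}(\mathscr N)=\sup_{q\in\mathcal P(\mathcal Y)}I_\alpha^{\mathbb M}(Y:B)$ and $C_\alpha^{\mathrm A,\mathbb M}(\mathscr N)=\sup_{q\in\mathcal P(\mathcal Y)}I_\alpha^{\mathrm A,\mathbb M}(Y:B)$, both evaluated at $\sum_y q(y)|y\rangle\langle y|\otimes\rho_B^y$, and let $R_\alpha^{\mathbb M}(\mathscr N)=\inf_{\sigma_B\in\mathcal S(\mathcal H_B)}\sup_{y\in\mathcal Y}D_\alpha^{\mathbb M}(\rho_B^y\|\sigma_B)$. The $\alpha$-leakage is, for $\alpha\in(1,\infty]$, $$\mathcal L_\alpha(X\to B)_\rho=\frac{\alpha}{\alpha-1}\log\frac{\sup_{\Pi_{XB}}\operatorname{Tr}\big[\rho_{XB}\Pi_{XB}^{(\alpha-1)/\alpha}\big]}{\sup_{q\in\mathcal P(\mathcal X)}\sum_x p_X(x)q(x)^{(\alpha-1)/\alpha}}$$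 (with $\frac{\alpha}{\alpha-1}=\frac{\alpha-1}{\alpha}=1$ for $\alpha=\infty$), where $\Pi_{XB}=\sum_x|x\rangle\langle x|\otimes\Pi_B^x$ ranges over POVMs $\{\Pi_B^x\}_{x\in\mathcal X}$ on $\mathcal H_B$. For $\alpha=1$, $$\mathcal L_1(X\to B)_\rho=\inf_{q\in\mathcal P(\mathcal X)}\Big(-\sum_x p_X(x)\log q(x)\Big)-\inf_{\Pi_{XB}}\big(-\operatorname{Tr}[\rho_{XB}\log\Pi_{XB}]\big),$$ where the first loss is $+\infty$ unless $\operatorname{supp}p_X\subseteq\operatorname{supp}q$ and the second is $+\infty$ unless $\operatorname{supp}\rho_{XB}\subseteq\operatorname{supp}\Pi_{XB}$. The maximal $\alpha$-leakage is $\mathcal L_\alpha^{\max}(X\to B)_\rho=\sup_{p_{S|X}:\,S-X-B}\mathcal L_\alpha(S\to B)_\rho$, the supremum being over all finite alphabets $\mathcal S$ and all conditional distributions $p_{S|X}$ on $\mathcal S$, with $\rho_{SB}=\sum_s|s\rangle\langle s|\otimes\sum_x p_{S|X}(s|x)p_X(x)\rho_B^x$. **Theorem.** For every $\alpha\in(1,\infty]$,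 $$\mathcal L_\alpha^{\max}(X\to B)_\rho=\sup_{p_{S|X}:\,S-X-B}I_\alpha^{\mathrm A,\mathbb M}(S:B)_\rho=C_\alpha^{\mathbb M}(\mathscr N_{\operatorname{supp}(p_X)\to B})=C_\alpha^{\mathrm A,\mathbb M}(\mathscr N_{\operatorname{supp}(p_X)\to B})=R_\alpha^{\mathbb M}(\mathscr N_{\operatorname{supp}(p_X)\to B}),$$ where $\mathscr N_{\operatorname{supp}(p_X)\to B}:x\mapsto\rho_B^x$ is the channel restricted to inputs in $\operatorname{supp}(p_X)$. For $\alpha=1$, $$\mathcal L_1^{\max}(X\to B)_\rho=\sup_{p_{S|X}:\,S-X-B}I_1^{\mathrm A,\mathbb M}(S:B)_\rho=I_1^{\mathrm A,\mathbb M}(X:B)_\rho.$$ -/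

import Mathlib

open scoped ENNReal Kronecker ComplexOrder

noncomputable section

namespace QLeakage

/-- Density operators on the finite-dimensional Hilbert space `ℂ^d`. -/
def IsDensity {d : Type*} [Fintype d] (ρ : Matrix d d ℂ) : Prop :=
  ρ.PosSemidef ∧ ρ.trace = 1

/-- Positive operator-valued measures on `ℂ^d` with outcomes in the finite set `ι`. -/
def IsPOVM {ι d : Type*} [Fintype ι] [Fintype d] [DecidableEq d]
    (E : ι → Matrix d d ℂ) : Prop :=
  (∀ i, (E i).PosSemidef) ∧ ∑ i, E i = 1

/-- Classical Rényi divergence of order `α ∈ [1, ∞]` of two nonnegative vectors on a finite set.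
For `1 < α < ∞` the sum is taken in `[0, ∞]`, where `0 ^ (1 - α) = ∞` and `0 * ∞ = 0`, so that
the value is `+∞` iff `P` is not absolutely continuous with respect to `Q`. -/
def renyiDiv {ι : Type*} [Fintype ι] (α : ℝ≥0∞) (P Q : ι → ℝ) : EReal :=
  open Classical in
  if α = 1 then
    if ∀ i, Q i = 0 → P i = 0 then ((∑ i, P i * Real.log (P i / Q i) : ℝ) : EReal) else ⊤
  else if α = ⊤ then
    ⨆ i, ENNReal.log (ENNReal.ofReal (P i) / ENNReal.ofReal (Q i))
  else
    ((1 / (α.toReal - 1) : ℝ) : EReal) *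
      ENNReal.log (∑ i, ENNReal.ofReal (P i) ^ α.toReal * ENNReal.ofReal (Q i) ^ (1 - α.toReal))

/-- Measured Rényi divergence `D_α^M(ρ‖σ)`: the supremum, over all POVMs with finitely many
outcomes, of the classical Rényi divergence of the outcome vectors. -/
def measuredDiv {d : Type*} [Fintype d] [DecidableEq d] (α : ℝ≥0∞)
    (ρ σ : Matrix d d ℂ) : EReal :=
  ⨆ (n : ℕ) (E : Fin n → Matrix d d ℂ) (_ : IsPOVM E),
    renyiDiv α (fun i => (ρ * E i).trace.re) (fun i => (σ * E i).trace.re)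

/-- Rényi entropy `H_α(p)` of order `α ∈ [1, ∞]` of a probability vector. -/
def renyiEntropy {X : Type*} [Fintype X] (α : ℝ≥0∞) (p : X → ℝ) : ℝ :=
  if α = 1 then -∑ x, p x * Real.log (p x)
  else if α = ⊤ then -Real.log (⨆ x, p x)
  else (1 / (1 - α.toReal)) * Real.log (∑ x, p x ^ α.toReal)

section CQ

variable {X B : Type*} [Fintype X] [DecidableEq X] [Fintype B] [DecidableEq B]

/-- The classical-quantum operator `∑ x, |x⟩⟨x| ⊗ τ x`. A c-q state with classical distribution
`p` and conditional states `ρ x` is the case `τ x = p x • ρ x`. -/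
def cqOp (τ : X → Matrix B B ℂ) : Matrix (X × B) (X × B) ℂ :=
  ∑ x, Matrix.single x x (1 : ℂ) ⊗ₖ τ x

/-- The family `τ x = p x • ρ x`. -/
def ensemble (p : X → ℝ) (ρ : X → Matrix B B ℂ) : X → Matrix B B ℂ :=
  fun x => (p x : ℂ) • ρ x

/-- The classical marginal distribution `x ↦ Tr[τ x]` of `cqOp τ`. -/
def classicalMarginal (τ : X → Matrix B B ℂ) : X → ℝ :=
  fun x => (τ x).trace.re

/-- The classical marginal of `cqOp τ`, as a diagonal operator `ρ_X`. -/
def marginalOp (τ : X → Matrix B B ℂ) : Matrix X X ℂ :=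
  Matrix.diagonal fun x => (classicalMarginal τ x : ℂ)

/-- Measured Rényi information
`I_α^M(X:B)_ρ = inf_{σ_B} D_α^M(ρ_XB ‖ ρ_X ⊗ σ_B)` of `ρ_XB = cqOp τ`. -/
def measuredInfo (α : ℝ≥0∞) (τ : X → Matrix B B ℂ) : EReal :=
  ⨅ (σ : Matrix B B ℂ) (_ : IsDensity σ), measuredDiv α (cqOp τ) (marginalOp τ ⊗ₖ σ)

/-- Measured conditional Rényi entropy
`H_α^M(X|B)_ρ = - inf_{σ_B} D_α^M(ρ_XB ‖ 1_X ⊗ σ_B)` of `ρ_XB = cqOp τ`. -/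
def measuredCondEntropy (α : ℝ≥0∞) (τ : X → Matrix B B ℂ) : EReal :=
  -⨅ (σ : Matrix B B ℂ) (_ : IsDensity σ),
    measuredDiv α (cqOp τ) ((1 : Matrix X X ℂ) ⊗ₖ σ)

/-- Measured Arimoto information `I_α^{A,M}(X:B)_ρ = H_α(X) - H_α^M(X|B)_ρ` of
`ρ_XB = cqOp τ`. -/
def arimotoInfo (α : ℝ≥0∞) (τ : X → Matrix B B ℂ) : EReal :=
  (renyiEntropy α (classicalMarginal τ) : EReal) - measuredCondEntropy α τ

/-- Measured Rényi capacity of the c-q channel `x ↦ N x`. -/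
def measuredCapacity (α : ℝ≥0∞) (N : X → Matrix B B ℂ) : EReal :=
  ⨆ (q : X → ℝ) (_ : q ∈ stdSimplex ℝ X), measuredInfo α (ensemble q N)

/-- Measured Arimoto capacity of the c-q channel `x ↦ N x`. -/
def arimotoCapacity (α : ℝ≥0∞) (N : X → Matrix B B ℂ) : EReal :=
  ⨆ (q : X → ℝ) (_ : q ∈ stdSimplex ℝ X), arimotoInfo α (ensemble q N)

/-- Measured Rényi divergence radius `inf_{σ_B} sup_x D_α^M(N x ‖ σ_B)` of the c-q channel
`x ↦ N x`. -/
def divergenceRadius {X B : Type*} [Fintype B] [DecidableEq B] (α : ℝ≥0∞)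
    (N : X → Matrix B B ℂ) : EReal :=
  ⨅ (σ : Matrix B B ℂ) (_ : IsDensity σ), ⨆ x, measuredDiv α (N x) σ

/-- The exponent `(α - 1) / α = 1 - 1 / α`, equal to `1` for `α = ∞`. -/
def gainExponent (α : ℝ≥0∞) : ℝ := 1 - α⁻¹.toReal

/-- Maximal expected `α`-gain with access to `B`:
`P_α(X|B)_ρ = sup Tr[ρ_XB Π_XB ^ ((α - 1) / α)]`, where the supremum runs over
`Π_XB = ∑ x, |x⟩⟨x| ⊗ E x` for POVMs `E` on `B` with outcomes in `X`. -/
def maxGain (α : ℝ≥0∞) (τ : X → Matrix B B ℂ) : ℝ≥0∞ :=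
  ⨆ (E : X → Matrix B B ℂ) (_ : IsPOVM E),
    ENNReal.ofReal (cqOp τ * cfc (fun t : ℝ => t ^ gainExponent α) (cqOp E)).trace.re

/-- Maximal expected `α`-gain without access to `B`:
`P_α(X) = sup_q ∑ x, p x * q x ^ ((α - 1) / α)`. -/
def priorGain (α : ℝ≥0∞) (p : X → ℝ) : ℝ≥0∞ :=
  ⨆ (q : X → ℝ) (_ : q ∈ stdSimplex ℝ X),
    ENNReal.ofReal (∑ x, p x * q x ^ gainExponent α)

/-- Expected log-loss `-Tr[ρ_XB log Π_XB]` of the POVM `E` when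
`supp ρ_XB ⊆ supp Π_XB` (that is, `ker Π_XB ⊆ ker ρ_XB`), and `+∞` otherwise. -/
def expectedLogLoss (τ E : X → Matrix B B ℂ) : EReal :=
  open Classical in
  if ∀ v : X × B → ℂ, (cqOp E).mulVec v = 0 → (cqOp τ).mulVec v = 0 then
    ((-(cqOp τ * cfc Real.log (cqOp E)).trace.re : ℝ) : EReal)
  else ⊤

/-- Minimal expected log-loss with access to `B`. -/
def minLogLoss (τ : X → Matrix B B ℂ) : EReal :=
  ⨅ (E : X → Matrix B B ℂ) (_ : IsPOVM E), expectedLogLoss τ E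

/-- Minimal expected log-loss `inf_q -∑ x, p x * log (q x)` without access to `B`; the value at
`q` is `+∞` if `q` vanishes where `p` does not. -/
def priorLogLoss (p : X → ℝ) : EReal :=
  open Classical in
  ⨅ (q : X → ℝ) (_ : q ∈ stdSimplex ℝ X),
    if ∀ x, q x = 0 → p x = 0 then ((-∑ x, p x * Real.log (q x) : ℝ) : EReal) else ⊤

/-- The `α`-leakage from `X` to `B`, for `α ∈ [1, ∞]`: `α / (α - 1)` times the logarithm of the
ratio of the maximal expected gains with and without access to `B` for `α > 1` (the prefactor
being `1` for `α = ∞`), and the decrease of the minimal expected log-loss for `α = 1`. -/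
def leakage (α : ℝ≥0∞) (τ : X → Matrix B B ℂ) : EReal :=
  if α = 1 then priorLogLoss (classicalMarginal τ) - minLogLoss τ
  else (((gainExponent α)⁻¹ : ℝ) : EReal) *
    ENNReal.log (maxGain α τ / priorGain α (classicalMarginal τ))

/-- For a Markov chain `S - X - B` given by `p_X`, the conditional distributions
`W x = p_{S|X=x}` and the states `ρ x`, the reduced state `ρ_SB` of
`ρ_SXB = ∑ s x, W x s |s⟩⟨s| ⊗ p x |x⟩⟨x| ⊗ ρ x` is `cqOp (markovEnsemble W p ρ)`. -/
def markovEnsemble {S : Type*} (W : X → S → ℝ) (p : X → ℝ) (ρ : X → Matrix B B ℂ) :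
    S → Matrix B B ℂ :=
  fun s => ∑ x, ((W x s * p x : ℝ) : ℂ) • ρ x

/-- Supremum of a functional of c-q states `ρ_SB` over all Markov chains `S - X - B` extending
`ρ_XB = ∑ x, p x |x⟩⟨x| ⊗ ρ x`, with `S` in an arbitrary finite alphabet. -/
def markovSup (p : X → ℝ) (ρ : X → Matrix B B ℂ)
    (F : (n : ℕ) → (Fin n → Matrix B B ℂ) → EReal) : EReal :=
  ⨆ (n : ℕ) (W : X → Fin n → ℝ) (_ : ∀ x, W x ∈ stdSimplex ℝ (Fin n)),
    F n (markovEnsemble W p ρ)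

/-- Maximal `α`-leakage `sup_{S - X - B} L_α(S → B)`. -/
def maxLeakage (α : ℝ≥0∞) (p : X → ℝ) (ρ : X → Matrix B B ℂ) : EReal :=
  markovSup p ρ fun _ τ => leakage α τ

/-- `sup_{S - X - B} I_α^{A,M}(S:B)`. -/
def maxArimotoInfo (α : ℝ≥0∞) (p : X → ℝ) (ρ : X → Matrix B B ℂ) : EReal :=
  markovSup p ρ fun _ τ => arimotoInfo α τ

/-- The c-q channel `x ↦ ρ x` restricted to inputs in the support of `p`. -/
def restrictSupp (p : X → ℝ) (ρ : X → Matrix B B ℂ) : {x // p x ≠ 0} → Matrix B B ℂ :=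
  fun x => ρ x

end CQ

end QLeakage

end

open QLeakage

namespace QLeakage

open Matrix
open scoped MatrixOrder

set_option linter.unusedSectionVars false

/-! ### Functional calculus of Hermitian matrices through intertwiners -/

section FunctionalCalculus

variable {m n : Type*} [Fintype m] [DecidableEq m] [Fintype n] [DecidableEq n]

/-! Write `β = (α - 1) / α` and let φ be `log` for `β = 0` and `t ↦ t ^ β` otherwise. The whole
proof rests on one variational formula: `D_α(P‖Q) ≤ r` holds iff `∑ P φ(g) ≤ bnd β r (∑ Q g)` for
all test functions `g`. It follows from Hölder's inequality for finite `α > 1`, a pointwise bound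
for `α = ∞`, and `log t ≤ t - 1` for `α = 1`. Measuring a test operator in its eigenbasis, together
with the operator Jensen inequality for φ, lifts it to measured divergences: `D_α^M(ρ‖σ) ≤ r` iff
`Tr ρ φ(Ω) ≤ bnd β r (Tr σ Ω)` for all `Ω` (`measuredDiv_le_iff`). For c-q operators block-diagonal
`Ω` suffice.

Exchanging `inf_σ` with the choice of `Ω` is a minimax argument. The tangent line of `bnd β r` makes
violations affine in `σ`; Sion's theorem produces a finite mixture of test operators valid for every
`σ`, and operator concavity of φ merges the mixture into one family (`exists_uniform_family`,
`exists_uniform_channel`).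

Leakage equals Arimoto information for every c-q state. A POVM is a test family with `∑ Tr σ E_x =
1`, which gives one inequality. Conversely, a uniform family divided by a number just above the
largest eigenvalue of its sum can be completed to a POVM (`exists_povm_of_forall_density`).

For `α > 1` every other quantity is compared with the divergence radius. A `σ` that nearly attains
the radius bounds all of them from above. From below, the minimax yields an input distribution `q`
and operators `Ω_x`. The input `q` itself serves the capacity and the tilted input proportional to
`q ^ (1 - β)` serves the Arimoto capacity. For Markov chains, where `p` is prescribed, splitting `x`
uniformly into `k_x` symbols turns its weight into `p_x k_x ^ (-β)`, and suitable `k_x` make this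
nearly proportional to `q_x ^ (1 - β)`.

For `α = 1` the entropy terms cancel against the logarithms of posterior probabilities, so Arimoto
information obeys data processing on the classical side and `S = X` is optimal
(`arimotoInfo_one_postProcess_le`). -/

theorem continuousOn_spectrum (f : ℝ → ℝ) (A : Matrix n n ℂ) : ContinuousOn f (spectrum ℝ A) :=
  Matrix.finite_real_spectrum.continuousOn f

/-- The functional calculus of Hermitian matrices respects intertwiners. -/
theorem cfc_mul_of_intertwine {M : Matrix m m ℂ} {N : Matrix n n ℂ} (hM : M.IsHermitian)
    (hN : N.IsHermitian) {V : Matrix m n ℂ} (h : M * V = V * N) (f : ℝ → ℝ) :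
    cfc f M * V = V * cfc f N := by
  classical
  have hfin : (spectrum ℝ M ∪ spectrum ℝ N).Finite :=
    Matrix.finite_real_spectrum.union Matrix.finite_real_spectrum
  -- Both spectra are finite, so a single polynomial agrees with `f` on their union, and polynomials
  -- pass through the intertwiner power by power.
  set s := hfin.toFinset
  set q := Lagrange.interpolate s id f
  have hq : ∀ t ∈ s, f t = q.eval t := fun t ht =>
    (Lagrange.eval_interpolate_at_node (v := id) f (Function.injective_id.injOn) ht).symm
  have h1 : cfc f M = Polynomial.aeval M q := by
    rw [← cfc_polynomial q M hM]
    exact cfc_congr fun t ht => hq t (by simp [s, ht])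
  have h2 : cfc f N = Polynomial.aeval N q := by
    rw [← cfc_polynomial q N hN]
    exact cfc_congr fun t ht => hq t (by simp [s, ht])
  have hpow : ∀ k : ℕ, M ^ k * V = V * N ^ k := by
    intro k
    induction k with
    | zero => simp
    | succ k ih => rw [pow_succ, Matrix.mul_assoc, h, ← Matrix.mul_assoc, ih, Matrix.mul_assoc,
        ← pow_succ]
  rw [h1, h2, Polynomial.aeval_eq_sum_range, Polynomial.aeval_eq_sum_range, Matrix.sum_mul,
    Matrix.mul_sum]
  exact Finset.sum_congr rfl fun k _ => by
    rw [Matrix.smul_mul, Matrix.mul_smul, hpow]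

theorem isHermitian_diagonal_ofReal (g : n → ℝ) :
    (diagonal fun i => (g i : ℂ)).IsHermitian := by
  rw [Matrix.isHermitian_diagonal_iff]
  intro i
  simp [isSelfAdjoint_iff]

/-- Each basis vector, viewed as a one-column matrix, intertwines the diagonal matrix with a scalar;
this gives the result column by column. -/
theorem cfc_diagonal_ofReal (f : ℝ → ℝ) (g : n → ℝ) :
    cfc f (diagonal fun i => (g i : ℂ)) = diagonal fun i => (f (g i) : ℂ) := by
  have key : ∀ j, cfc f (diagonal fun i => (g i : ℂ)) * Matrix.replicateCol Unit (Pi.single j (1 : ℂ))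
      = Matrix.replicateCol Unit (Pi.single j (1 : ℂ)) * (algebraMap ℝ (Matrix Unit Unit ℂ) (f (g j))) := by
    intro j
    rw [← cfc_algebraMap (g j) f]
    refine cfc_mul_of_intertwine (isHermitian_diagonal_ofReal g) ?_ ?_ f
    · exact (IsSelfAdjoint.algebraMap _ (IsSelfAdjoint.all (g j)))
    · ext a b
      by_cases h : a = j <;>
        simp [h, Matrix.mul_apply, Matrix.algebraMap_matrix_apply, Matrix.diagonal_apply,
          Pi.single_apply, mul_comm]
  ext i j
  have := congrFun (congrFun (key j) i) ()
  by_cases h : i = j <;>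
  simpa [Matrix.mul_apply, Matrix.algebraMap_matrix_apply, Matrix.diagonal_apply,
    Pi.single_apply, h] using this

end FunctionalCalculus

/-! ### Operator concavity and monotonicity of log and powers -/

section Phi

/-- `log` for `β = 0` and `t ↦ t ^ β` otherwise. -/
noncomputable def phi (β : ℝ) : ℝ → ℝ := if β = 0 then Real.log else fun t => t ^ β

/-- The domain of `phi β` among reals. -/
def PhiDom (β t : ℝ) : Prop := if β = 0 then 0 < t else 0 ≤ t

variable {n : Type*} [Fintype n] [DecidableEq n]

/-- The domain of `phi β` among matrices. -/
def MatDom {n : Type*} (β : ℝ) (A : Matrix n n ℂ) : Prop :=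
  if β = 0 then A.PosDef else A.PosSemidef

theorem PhiDom.nonneg {β t : ℝ} (h : PhiDom β t) : 0 ≤ t := by
  unfold PhiDom at h; split_ifs at h <;> linarith

theorem MatDom.posSemidef {n : Type*} {β : ℝ} {A : Matrix n n ℂ} (h : MatDom β A) :
    A.PosSemidef := by
  unfold MatDom at h; split_ifs at h
  exacts [h.posSemidef, h]

theorem MatDom.of_posDef {n : Type*} {β : ℝ} {A : Matrix n n ℂ} (h : A.PosDef) : MatDom β A := by
  unfold MatDom; split_ifs
  exacts [h, h.posSemidef]

theorem MatDom.add_posSemidef {β : ℝ} {A C : Matrix n n ℂ} (hA : MatDom β A)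
    (hC : C.PosSemidef) : MatDom β (A + C) := by
  unfold MatDom at *
  split_ifs at *
  exacts [hA.add_posSemidef hC, hA.add hC]

theorem MatDom.smul {β : ℝ} {A : Matrix n n ℂ} (hA : MatDom β A) {c : ℝ} (hc : 0 < c) :
    MatDom β (c • A) := by
  unfold MatDom at *
  split_ifs at *
  exacts [hA.smul hc, hA.smul hc.le]

theorem convex_matDom (β : ℝ) : Convex ℝ {A : Matrix n n ℂ | MatDom β A} := by
  intro A hA C hC s t hs ht hst
  rcases hs.eq_or_lt with rfl | hs
  · have : t = 1 := by linarith
    simpa [this] using hC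
  · exact (MatDom.smul hA hs).add_posSemidef ((MatDom.posSemidef hC).smul ht)

open scoped Matrix.Norms.L2Operator in
theorem concaveOn_cfc_phi {β : ℝ} (hβ : β ∈ Set.Icc (0 : ℝ) 1) :
    ConcaveOn ℝ {A : Matrix n n ℂ | MatDom β A} (cfc (phi β)) := by
  by_cases h0 : β = 0
  · have := CFC.concaveOn_log (A := Matrix n n ℂ)
    simp only [isStrictlyPositive_iff_posDef] at this
    simp only [MatDom, phi, h0, if_true]
    exact ⟨this.1, fun A hA C hC s t hs ht hst => this.2 hA hC hs ht hst⟩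
  · have := CFC.concaveOn_rpow (A := Matrix n n ℂ) hβ
    simp only [MatDom, phi, h0, if_false]
    refine ⟨?_, ?_⟩
    · simpa [MatDom, h0] using convex_matDom (n := n) β
    · intro A hA C hC s t hs ht hst
      have h := this.2 (Set.mem_Ici.2 (PosSemidef.nonneg hA)) (Set.mem_Ici.2 (PosSemidef.nonneg hC))
        hs ht hst
      simp only at h
      rwa [CFC.rpow_eq_cfc_real (PosSemidef.nonneg hA), CFC.rpow_eq_cfc_real (PosSemidef.nonneg hC),
        CFC.rpow_eq_cfc_real
          (PosSemidef.nonneg ((PosSemidef.smul hA hs).add (PosSemidef.smul hC ht)))] at h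

open scoped Matrix.Norms.L2Operator in
-- The Löwner–Heinz inequality and its logarithmic counterpart. It is what permits enlarging a test
-- operator, as when a sub-POVM is completed.
theorem cfc_phi_mono {β : ℝ} (hβ : β ∈ Set.Icc (0 : ℝ) 1) {A C : Matrix n n ℂ}
    (hA : MatDom β A) (h : A ≤ C) : cfc (phi β) A ≤ cfc (phi β) C := by
  by_cases h0 : β = 0
  · simp only [MatDom, phi, h0, if_true] at *
    exact CFC.log_le_log h hA.isStrictlyPositive
  · simp only [MatDom, phi, h0, if_false] at *
    have := CFC.rpow_le_rpow hβ h
    rwa [CFC.rpow_eq_cfc_real hA.nonneg, CFC.rpow_eq_cfc_real (hA.nonneg.trans h)] at this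

theorem matDom_diagonal {β : ℝ} {g : n → ℝ} (hg : ∀ i, PhiDom β (g i)) :
    MatDom β (diagonal fun i => (g i : ℂ)) := by
  unfold MatDom PhiDom at *
  split_ifs at * with h
  · exact Matrix.PosDef.diagonal fun i => by exact_mod_cast hg i
  · exact Matrix.PosSemidef.diagonal fun i => by
      simp only [Pi.zero_apply]; exact_mod_cast hg i

end Phi

/-! ### Operator Jensen inequality -/

section Jensen

variable {n ι : Type*} [Fintype n] [DecidableEq n] [Fintype ι] [DecidableEq ι]

theorem MatDom.unitary_conj {β : ℝ} {A U : Matrix n n ℂ} (hA : MatDom β A)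
    (hU : Uᴴ * U = 1) : MatDom β (Uᴴ * A * U) := by
  unfold MatDom at *
  split_ifs at *
  · refine hA.conjTranspose_mul_mul_same ?_
    intro x y hxy
    have := congrArg (fun v => Uᴴ *ᵥ v) hxy
    simpa [hU] using this
  · exact hA.conjTranspose_mul_mul_same _

/-- Compression form of the operator Jensen inequality for isometries. -/
theorem cfc_phi_compression {β : ℝ} (hβ : β ∈ Set.Icc (0 : ℝ) 1) {m : Type*} [Fintype m]
    [DecidableEq m] {D : Matrix m m ℂ} (hD : MatDom β D) {V : Matrix m n ℂ} (hV : Vᴴ * V = 1) :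
    Vᴴ * cfc (phi β) D * V ≤ cfc (phi β) (Vᴴ * D * V) := by
  -- `U` is the reflection fixing the range of `V`. Averaging `D` with `U * D * U` removes the
  -- off-diagonal blocks relative to that range, so `V` intertwines the average with the compression
  -- of `D`; concavity is then applied to this average.
  set P := V * Vᴴ with hP
  set U := (2 : ℂ) • P - 1 with hU
  have hPV : P * V = V := by rw [hP, Matrix.mul_assoc, hV, Matrix.mul_one]
  have hPP : P * P = P := by
    rw [hP, Matrix.mul_assoc, ← Matrix.mul_assoc Vᴴ, hV, Matrix.one_mul]
  have hPh : Pᴴ = P := by simp [hP]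
  have hUh : Uᴴ = U := by simp [hU, hPh]
  have hUU : U * U = 1 := by
    simp only [hU, sub_mul, mul_sub, smul_mul_assoc, mul_smul_comm, hPP, mul_one, one_mul]
    module
  have hUV : U * V = V := by
    rw [hU, Matrix.sub_mul, Matrix.smul_mul, hPV, Matrix.one_mul]; module
  have hVU : Vᴴ * U = Vᴴ := by
    have := congrArg conjTranspose hUV
    rwa [conjTranspose_mul, hUh] at this
  have hD' : MatDom β (U * D * U) := by
    simpa [hUh] using hD.unitary_conj (U := U) (by rw [hUh, hUU])
  have hDh := hD.posSemidef.isHermitian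
  have hDh' := hD'.posSemidef.isHermitian
  set M := (1 / 2 : ℝ) • D + (1 / 2 : ℝ) • (U * D * U) with hM
  have hMd : MatDom β M := convex_matDom β hD hD' (by norm_num) (by norm_num) (by norm_num)
  have hconc : (1 / 2 : ℝ) • cfc (phi β) D + (1 / 2 : ℝ) • cfc (phi β) (U * D * U) ≤
      cfc (phi β) M := (concaveOn_cfc_phi hβ).2 hD hD' (by norm_num) (by norm_num) (by norm_num)
  have h1 : cfc (phi β) (U * D * U) * U = U * cfc (phi β) D :=
    cfc_mul_of_intertwine hDh' hDh (by rw [Matrix.mul_assoc, hUU, Matrix.mul_one]) _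
  have h2 : cfc (phi β) (U * D * U) = U * cfc (phi β) D * U := by
    rw [← h1, Matrix.mul_assoc _ U U, hUU, Matrix.mul_one]
  have hMV : M * V = V * (Vᴴ * D * V) := by
    have : U * D * U * V = (2 : ℂ) • (P * (D * V)) - D * V := by
      rw [Matrix.mul_assoc _ U V, hUV, hU, Matrix.mul_assoc, Matrix.sub_mul, Matrix.smul_mul,
        Matrix.one_mul]
    rw [hM, Matrix.add_mul, Matrix.smul_mul, Matrix.smul_mul, this, hP]
    simp only [Matrix.mul_assoc]
    module
  have h3 : cfc (phi β) M * V = V * cfc (phi β) (Vᴴ * D * V) :=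
    cfc_mul_of_intertwine hMd.posSemidef.isHermitian
      (isHermitian_conjTranspose_mul_mul _ hDh) hMV _
  have h4 : cfc (phi β) (Vᴴ * D * V) = Vᴴ * cfc (phi β) M * V := by
    rw [Matrix.mul_assoc Vᴴ (cfc _ _) V, h3, ← Matrix.mul_assoc, hV, Matrix.one_mul]
  rw [h4]
  have h5 := (Matrix.le_iff.1 hconc).conjTranspose_mul_mul_same V
  rw [Matrix.le_iff]
  convert h5 using 1
  rw [h2, Matrix.mul_sub, Matrix.sub_mul, Matrix.mul_add, Matrix.add_mul, Matrix.mul_smul,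
    Matrix.mul_smul, Matrix.smul_mul, Matrix.smul_mul]
  have h6 : Vᴴ * (U * cfc (phi β) D * U) * V = Vᴴ * cfc (phi β) D * V := by
    calc Vᴴ * (U * cfc (phi β) D * U) * V = (Vᴴ * U) * cfc (phi β) D * (U * V) := by
          simp only [Matrix.mul_assoc]
      _ = _ := by rw [hVU, hUV]
  rw [h6]
  module

/-- Naimark dilation: factor each `E i` as `star (S i) * S i` and stack the factors. Taking `g = 1`
shows that `V` is an isometry. -/
theorem exists_dilation {E : ι → Matrix n n ℂ} (hE : IsPOVM E) :
    ∃ V : Matrix (n × ι) n ℂ, ∀ g : ι → ℝ,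
      Vᴴ * (diagonal fun x => (g x.2 : ℂ) : Matrix (n × ι) (n × ι) ℂ) * V = ∑ i, g i • E i := by
  choose S hS using fun i => CStarAlgebra.nonneg_iff_eq_star_mul_self.mp (hE.1 i).nonneg
  refine ⟨Matrix.of fun x b => S x.2 x.1 b, fun g => ?_⟩
  ext a b
  rw [Matrix.mul_apply, Matrix.sum_apply, Fintype.sum_prod_type_right]
  refine Finset.sum_congr rfl fun i _ => ?_
  rw [Matrix.smul_apply, hS, Matrix.mul_apply, Finset.smul_sum]
  refine Finset.sum_congr rfl fun j _ => ?_
  rw [Matrix.mul_diagonal]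
  simp only [Matrix.conjTranspose_apply, Matrix.of_apply, star_eq_conjTranspose, Complex.real_smul]
  ring

/-- The compression inequality applied to the diagonal matrix of the `g i` in the Naimark dilation.
-/
theorem cfc_phi_jensen {β : ℝ} (hβ : β ∈ Set.Icc (0 : ℝ) 1) {E : ι → Matrix n n ℂ}
    (hE : IsPOVM E) {g : ι → ℝ} (hg : ∀ i, PhiDom β (g i)) :
    ∑ i, phi β (g i) • E i ≤ cfc (phi β) (∑ i, g i • E i) := by
  obtain ⟨V, hV⟩ := exists_dilation hE
  have h1 : Vᴴ * V = 1 := by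
    have := hV 1
    simpa [hE.2] using this
  have := cfc_phi_compression hβ (matDom_diagonal (n := n × ι) fun x => hg x.2) h1
  rwa [cfc_diagonal_ofReal, hV, hV (fun i => phi β (g i))] at this

theorem matDom_povm_sum {β : ℝ} {E : ι → Matrix n n ℂ}
    (hE : IsPOVM E) {g : ι → ℝ} (hg : ∀ i, PhiDom β (g i)) :
    MatDom β (∑ i, g i • E i) := by
  obtain ⟨V, hV⟩ := exists_dilation hE
  have h1 : Vᴴ * V = 1 := by
    have := hV 1
    simpa [hE.2] using this
  rw [← hV]
  have := matDom_diagonal (n := n × ι) fun x => hg x.2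
  unfold MatDom at *
  split_ifs at *
  · refine this.conjTranspose_mul_mul_same ?_
    intro x y hxy
    have := congrArg (fun v => Vᴴ *ᵥ v) hxy
    simpa [h1] using this
  · exact this.conjTranspose_mul_mul_same _

end Jensen

/-! ### Trace pairing and spectral measurements -/

section TracePairing

variable {n : Type*} [Fintype n] [DecidableEq n]

/-- The real trace pairing `Re Tr[ρ A]`. -/
noncomputable def trPair (ρ A : Matrix n n ℂ) : ℝ := (ρ * A).trace.re

theorem trPair_def (ρ A : Matrix n n ℂ) : (ρ * A).trace.re = trPair ρ A := rfl

theorem trPair_add (ρ A C : Matrix n n ℂ) : trPair ρ (A + C) = trPair ρ A + trPair ρ C := by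
  simp [trPair, mul_add]

theorem trPair_sub (ρ A C : Matrix n n ℂ) : trPair ρ (A - C) = trPair ρ A - trPair ρ C := by
  simp [trPair, mul_sub]

theorem trPair_smul (ρ A : Matrix n n ℂ) (c : ℝ) : trPair ρ (c • A) = c * trPair ρ A := by
  simp [trPair]

theorem trPair_sum {ι : Type*} (s : Finset ι) (ρ : Matrix n n ℂ) (A : ι → Matrix n n ℂ) :
    trPair ρ (∑ i ∈ s, A i) = ∑ i ∈ s, trPair ρ (A i) := by
  simp [trPair, Matrix.mul_sum, Matrix.trace_sum]

theorem trPair_comm (ρ A : Matrix n n ℂ) : trPair ρ A = trPair A ρ := by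
  simp [trPair, Matrix.trace_mul_comm ρ A]

theorem trPair_sum_left {ι : Type*} (s : Finset ι) (ρ : ι → Matrix n n ℂ) (A : Matrix n n ℂ) :
    trPair (∑ i ∈ s, ρ i) A = ∑ i ∈ s, trPair (ρ i) A := by
  simp [trPair, Matrix.sum_mul, Matrix.trace_sum]

theorem trPair_smul_left (ρ A : Matrix n n ℂ) (c : ℝ) : trPair (c • ρ) A = c * trPair ρ A := by
  simp [trPair]

theorem trPair_ofReal_smul_left (ρ A : Matrix n n ℂ) (c : ℝ) :
    trPair ((c : ℂ) • ρ) A = c * trPair ρ A := by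
  simp [trPair]

theorem trPair_one (ρ : Matrix n n ℂ) : trPair ρ 1 = ρ.trace.re := by
  simp [trPair]

theorem trPair_nonneg {ρ A : Matrix n n ℂ} (hρ : ρ.PosSemidef) (hA : A.PosSemidef) :
    0 ≤ trPair ρ A := by
  obtain ⟨S, rfl⟩ := CStarAlgebra.nonneg_iff_eq_star_mul_self.mp hA.nonneg
  rw [trPair, star_eq_conjTranspose, ← Matrix.mul_assoc, Matrix.trace_mul_comm, ← Matrix.mul_assoc]
  exact (Complex.nonneg_iff.1 (hρ.mul_mul_conjTranspose_same S).trace_nonneg).1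

theorem trPair_mono {ρ A C : Matrix n n ℂ} (hρ : ρ.PosSemidef) (h : A ≤ C) :
    trPair ρ A ≤ trPair ρ C := by
  have := trPair_nonneg hρ (Matrix.le_iff.1 h)
  rw [trPair_sub] at this
  linarith

theorem IsDensity.trace_re {ρ : Matrix n n ℂ} (h : IsDensity ρ) : ρ.trace.re = 1 := by
  simp [h.2]

theorem IsPOVM.sum_trPair {ι : Type*} [Fintype ι] {E : ι → Matrix n n ℂ} (hE : IsPOVM E)
    (ρ : Matrix n n ℂ) : ∑ i, trPair ρ (E i) = ρ.trace.re := by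
  rw [← trPair_sum, hE.2, trPair_one]

/-- The spectral measure of a Hermitian matrix as a POVM. -/
theorem exists_spectral_povm {A : Matrix n n ℂ} (hA : A.IsHermitian) :
    ∃ E : n → Matrix n n ℂ, IsPOVM E ∧
      ∀ f : ℝ → ℝ, cfc f A = ∑ i, f (hA.eigenvalues i) • E i := by
  set U : Matrix n n ℂ := (hA.eigenvectorUnitary : Matrix n n ℂ)
  have hcfc : ∀ f : ℝ → ℝ, cfc f A = ∑ i, f (hA.eigenvalues i) •
      (U * diagonal (Pi.single i (1 : ℂ)) * Uᴴ) := by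
    intro f
    rw [hA.cfc_eq, IsHermitian.cfc, Unitary.conjStarAlgAut_apply]
    have hd : diagonal (RCLike.ofReal ∘ f ∘ hA.eigenvalues) =
        ∑ i, f (hA.eigenvalues i) • diagonal (Pi.single i (1 : ℂ)) := by
      ext i j
      rw [Matrix.sum_apply]
      by_cases h : i = j <;> simp [h, Pi.single_apply]
    rw [hd, Matrix.mul_sum, Matrix.sum_mul]
    refine Finset.sum_congr rfl fun i _ => ?_
    rw [Matrix.mul_smul, Matrix.smul_mul]
    rfl
  refine ⟨_, ⟨fun i => ?_, ?_⟩, hcfc⟩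
  · refine PosSemidef.mul_mul_conjTranspose_same (PosSemidef.diagonal fun j => ?_) U
    by_cases h : j = i <;> simp [h]
  · have := hcfc (fun _ => 1)
    have h1 : cfc (fun _ => (1 : ℝ)) A = 1 := cfc_const_one ℝ A hA
    simpa [h1] using this.symm

theorem exists_spectral_povm' {A : Matrix n n ℂ} (hA : A.IsHermitian) :
    ∃ E : n → Matrix n n ℂ, IsPOVM E ∧ A = ∑ i, hA.eigenvalues i • E i ∧
      ∀ f : ℝ → ℝ, cfc f A = ∑ i, f (hA.eigenvalues i) • E i := by
  obtain ⟨E, hE, h⟩ := exists_spectral_povm hA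
  refine ⟨E, hE, ?_, h⟩
  rw [← h (fun t => t)]
  exact (cfc_id' ℝ A hA).symm

theorem MatDom.phiDom_eigenvalues {β : ℝ} {A : Matrix n n ℂ} (h : MatDom β A)
    (hA : A.IsHermitian) (i : n) : PhiDom β (hA.eigenvalues i) := by
  unfold MatDom PhiDom at *
  split_ifs at *
  exacts [h.eigenvalues_pos i, h.eigenvalues_nonneg i]

end TracePairing

/-! ### Variational formula for the classical and measured Rényi divergences -/

section Classical

variable {ι : Type*} [Fintype ι]

/-- The upper bound `s ↦ G_r(s)` appearing in the variational characterization of `D_α ≤ r`. -/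
noncomputable def bnd (β r s : ℝ) : ℝ :=
  if β = 0 then r + s - 1 else Real.exp (β * r) * s ^ β

theorem phi_zero : phi 0 = Real.log := by simp [phi]

theorem phi_of_ne {β : ℝ} (h : β ≠ 0) : phi β = fun t => t ^ β := by simp [phi, h]

/-- The bound `log t ≤ t - 1` at `t = Q g / P`, with equality at `g = P / Q`; the constant `-1` is
the total mass of `P`. -/
theorem renyiDiv_one_le_iff {P Q : ι → ℝ} (hP : ∀ i, 0 ≤ P i) (hQ : ∀ i, 0 ≤ Q i)
    (hP1 : ∑ i, P i = 1) (r : ℝ) :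
    renyiDiv 1 P Q ≤ r ↔
      ∀ g : ι → ℝ, (∀ i, 0 < g i) → ∑ i, P i * Real.log (g i) ≤ r + ∑ i, Q i * g i - 1 := by
  classical
  constructor
  · intro h g hg
    unfold renyiDiv at h
    rw [if_pos rfl] at h
    split_ifs at h with hac
    · rw [EReal.coe_le_coe_iff] at h
      have key : ∀ i, P i * Real.log (g i) - P i * Real.log (P i / Q i) ≤ Q i * g i - P i := by
        intro i
        rcases (hP i).eq_or_lt with h0 | h0
        · rw [← h0]; simp; exact mul_nonneg (hQ i) (hg i).le
        · have hQi : 0 < Q i := (hQ i).lt_of_ne fun hq => h0.ne' (hac i hq.symm)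
          have h1 := Real.log_le_sub_one_of_pos (show 0 < Q i * g i / P i by
            have := hg i; positivity)
          rw [← mul_sub, Real.log_div h0.ne' hQi.ne']
          rw [Real.log_div (mul_pos hQi (hg i)).ne' h0.ne', Real.log_mul hQi.ne' (hg i).ne'] at h1
          have h2 := mul_le_mul_of_nonneg_left h1 h0.le
          have h3 : P i * (Q i * g i / P i - 1) = Q i * g i - P i := by field_simp
          rw [h3] at h2
          refine le_trans (le_of_eq ?_) h2
          ring
      have := Finset.sum_le_sum fun i (_ : i ∈ Finset.univ) => key i
      rw [Finset.sum_sub_distrib, Finset.sum_sub_distrib, hP1] at this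
      linarith
    · exact absurd h (by simp)
  · intro h
    have hac : ∀ i, Q i = 0 → P i = 0 := by
      by_contra! hcon
      obtain ⟨i, hqi, hpi⟩ := hcon
      have hpi' : 0 < P i := (hP i).lt_of_ne hpi.symm
      obtain ⟨M, hM⟩ : ∃ M : ℝ, r + ∑ j, Q j - 1 < P i * M :=
        ⟨(r + ∑ j, Q j) / P i, by field_simp; linarith⟩
      -- Where `Q` vanishes, a huge value of `g` costs nothing on the right and is unbounded on the
      -- left, so absolute continuity is forced.
      have h1 := h (fun j => if j = i then Real.exp M else 1) (fun j => by
        split_ifs <;> positivity)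
      have h2 : ∑ j, P j * Real.log (if j = i then Real.exp M else 1) = P i * M := by
        rw [Finset.sum_eq_single i]
        · simp
        · intro j _ hj; simp [hj]
        · simp
      have h3 : ∑ j, Q j * (if j = i then Real.exp M else 1) = ∑ j, Q j := by
        refine Finset.sum_congr rfl fun j _ => ?_
        by_cases hj : j = i
        · rw [hj, hqi]; simp
        · simp [hj]
      rw [h2, h3] at h1
      linarith
    unfold renyiDiv
    rw [if_pos rfl, if_pos hac, EReal.coe_le_coe_iff]
    -- The optimizer `P / Q` is not strictly positive where `P` vanishes; it is replaced there by
    -- `ε`, which is later sent to zero.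
    have key : ∀ ε : ℝ, 0 < ε → ∑ i, P i * Real.log (P i / Q i) ≤ r + ε * ∑ i, Q i := by
      intro ε hε
      have h1 := h (fun j => if P j = 0 then ε else P j / Q j) (fun j => by
        split_ifs with hj
        · exact hε
        · exact div_pos ((hP j).lt_of_ne (Ne.symm hj))
            ((hQ j).lt_of_ne fun hq => hj (hac j hq.symm)))
      have h2 : ∑ j, P j * Real.log (if P j = 0 then ε else P j / Q j) =
          ∑ j, P j * Real.log (P j / Q j) := by
        refine Finset.sum_congr rfl fun j _ => ?_
        by_cases hj : P j = 0 <;> simp [hj]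
      have h3 : ∑ j, Q j * (if P j = 0 then ε else P j / Q j) ≤ ∑ j, (P j + ε * Q j) := by
        refine Finset.sum_le_sum fun j _ => ?_
        by_cases hj : P j = 0
        · simp [hj, mul_comm]
        · have : Q j ≠ 0 := fun hq => hj (hac j hq)
          simp only [hj, if_false]
          rw [mul_div_cancel₀ _ this]
          have := mul_nonneg hε.le (hQ j)
          linarith
      rw [Finset.sum_add_distrib, hP1, ← Finset.mul_sum] at h3
      rw [h2] at h1
      linarith
    refine le_of_forall_pos_le_add fun δ hδ => ?_
    have hS : 0 ≤ ∑ i, Q i := Finset.sum_nonneg fun i _ => hQ i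
    have := key (δ / (1 + ∑ i, Q i)) (by positivity)
    have h4 : δ / (1 + ∑ i, Q i) * ∑ i, Q i ≤ δ := by
      rw [div_mul_eq_mul_div, div_le_iff₀ (by positivity)]
      nlinarith
    linarith

theorem gainExponent_one : gainExponent 1 = 0 := by simp [gainExponent]

theorem gainExponent_top : gainExponent ⊤ = 1 := by simp [gainExponent]

theorem gainExponent_mem {α : ℝ≥0∞} (h : 1 ≤ α) : gainExponent α ∈ Set.Icc (0 : ℝ) 1 := by
  have h1 : α⁻¹ ≤ 1 := ENNReal.inv_le_one.2 h
  have h2 : (α⁻¹).toReal ≤ 1 := by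
    simpa using ENNReal.toReal_mono ENNReal.one_ne_top h1
  constructor
  · simp only [gainExponent]; linarith
  · simp [gainExponent]

theorem gainExponent_pos {α : ℝ≥0∞} (h : 1 < α) : 0 < gainExponent α := by
  have h1 : α⁻¹ < 1 := ENNReal.inv_lt_one.2 h
  have h2 : (α⁻¹).toReal < 1 := by
    simpa using (ENNReal.toReal_lt_toReal (h1.trans ENNReal.one_lt_top).ne ENNReal.one_ne_top).2 h1
  simp only [gainExponent]; linarith

/-- Both sides amount to the pointwise bound `P ≤ exp r * Q`; indicator functions recover it from
the right-hand side. -/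
theorem renyiDiv_top_le_iff {P Q : ι → ℝ} (hP : ∀ i, 0 ≤ P i) (hQ : ∀ i, 0 ≤ Q i) (r : ℝ) :
    renyiDiv ⊤ P Q ≤ r ↔
      ∀ g : ι → ℝ, (∀ i, 0 ≤ g i) → ∑ i, P i * g i ≤ Real.exp r * ∑ i, Q i * g i := by
  classical
  have h0 : renyiDiv ⊤ P Q ≤ r ↔ ∀ i, P i ≤ Real.exp r * Q i := by
    unfold renyiDiv
    rw [if_neg (by simp), if_pos rfl, iSup_le_iff]
    refine forall_congr' fun i => ?_
    have hr : (r : EReal) = ENNReal.log (ENNReal.ofReal (Real.exp r)) := by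
      rw [ENNReal.log_ofReal_of_pos (Real.exp_pos r), Real.log_exp]
    rw [hr, ENNReal.log_le_log_iff]
    rcases (hQ i).eq_or_lt with hq | hq
    · rw [← hq]
      rcases (hP i).eq_or_lt with hp | hp
      · rw [← hp]; simp
      · simp only [ENNReal.ofReal_zero, mul_zero]
        rw [ENNReal.div_zero (by simpa using hp)]
        simpa using hp
    · rw [ENNReal.div_le_iff (by simpa using hq) ENNReal.ofReal_ne_top,
        ← ENNReal.ofReal_mul (Real.exp_pos r).le, ENNReal.ofReal_le_ofReal_iff (by positivity)]
  rw [h0]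
  constructor
  · intro h g hg
    rw [Finset.mul_sum]
    refine Finset.sum_le_sum fun i _ => ?_
    rw [← mul_assoc]
    exact mul_le_mul_of_nonneg_right (h i) (hg i)
  · intro h i
    simpa [Pi.single_apply] using h (Pi.single i 1) (fun j => by
      by_cases hj : j = i <;> simp [hj])

theorem gainExponent_of_ne_top {α : ℝ≥0∞} : gainExponent α = 1 - (α.toReal)⁻¹ := by
  rw [gainExponent, ENNReal.toReal_inv]

theorem renyiDiv_finite_le_iff_sum {α : ℝ≥0∞} (h1 : 1 < α) (ht : α ≠ ⊤) (P Q : ι → ℝ) (r : ℝ) :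
    renyiDiv α P Q ≤ r ↔
      ∑ i, ENNReal.ofReal (P i) ^ α.toReal * ENNReal.ofReal (Q i) ^ (1 - α.toReal) ≤
        ENNReal.ofReal (Real.exp ((α.toReal - 1) * r)) := by
  classical
  have ha : 1 < α.toReal := by
    simpa using (ENNReal.toReal_lt_toReal ENNReal.one_ne_top ht).2 h1
  have hpos : (0 : ℝ) < 1 / (α.toReal - 1) := by
    apply one_div_pos.2; linarith
  unfold renyiDiv
  rw [if_neg h1.ne', if_neg ht]
  set T := ∑ i, ENNReal.ofReal (P i) ^ α.toReal * ENNReal.ofReal (Q i) ^ (1 - α.toReal)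
  have hr : (((α.toReal - 1) * r : ℝ) : EReal) =
      ENNReal.log (ENNReal.ofReal (Real.exp ((α.toReal - 1) * r))) := by
    rw [ENNReal.log_ofReal_of_pos (Real.exp_pos _), Real.log_exp]
  rw [← ENNReal.log_le_log_iff, ← hr]
  induction hT : ENNReal.log T with
  | bot => rw [EReal.coe_mul_bot_of_pos hpos]; simp only [bot_le]
  | top =>
    rw [EReal.coe_mul_top_of_pos hpos]
    exact iff_of_false (EReal.coe_lt_top _).not_ge (EReal.coe_lt_top _).not_ge
  | coe x =>
    rw [← EReal.coe_mul, EReal.coe_le_coe_iff, EReal.coe_le_coe_iff, one_div,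
      inv_mul_le_iff₀ (by linarith)]

/-- Hölder with conjugate exponents `α` and `1 / β`, splitting `P g ^ β` as `(P Q ^ (-β)) (Q g) ^
β`; the extremal choice is `g = (P / Q) ^ α`. -/
theorem renyiDiv_finite_le_iff {α : ℝ≥0∞} (h1 : 1 < α) (ht : α ≠ ⊤) {P Q : ι → ℝ}
    (hP : ∀ i, 0 ≤ P i) (hQ : ∀ i, 0 ≤ Q i) (r : ℝ) :
    renyiDiv α P Q ≤ r ↔
      ∀ g : ι → ℝ, (∀ i, 0 ≤ g i) → ∑ i, P i * g i ^ gainExponent α ≤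
        Real.exp (gainExponent α * r) * (∑ i, Q i * g i) ^ gainExponent α := by
  classical
  have ha : 1 < α.toReal := by
    simpa using (ENNReal.toReal_lt_toReal ENNReal.one_ne_top ht).2 h1
  rw [renyiDiv_finite_le_iff_sum h1 ht]
  have hβ : gainExponent α = 1 - (α.toReal)⁻¹ := gainExponent_of_ne_top
  set a := α.toReal
  set β := gainExponent α
  have hβ0 : 0 < β := gainExponent_pos h1
  have hab : a * β = a - 1 := by rw [hβ]; field_simp
  have ha0 : 0 < a := by linarith
  by_cases hac : ∀ i, Q i = 0 → P i = 0
  · have hsum : ∑ i, ENNReal.ofReal (P i) ^ a * ENNReal.ofReal (Q i) ^ (1 - a) =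
        ENNReal.ofReal (∑ i, P i ^ a * Q i ^ (1 - a)) := by
      rw [ENNReal.ofReal_sum_of_nonneg fun i _ => mul_nonneg (Real.rpow_nonneg (hP i) _)
        (Real.rpow_nonneg (hQ i) _)]
      refine Finset.sum_congr rfl fun i _ => ?_
      rcases (hQ i).eq_or_lt with hq | hq
      · rw [hac i hq.symm]
        simp [ENNReal.zero_rpow_of_pos ha0, Real.zero_rpow ha0.ne']
      · rw [ENNReal.ofReal_mul (Real.rpow_nonneg (hP i) _), ENNReal.ofReal_rpow_of_pos hq,
          ENNReal.ofReal_rpow_of_nonneg (hP i) ha0.le]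
    rw [hsum, ENNReal.ofReal_le_ofReal_iff (Real.exp_pos _).le]
    set T := ∑ i, P i ^ a * Q i ^ (1 - a) with hT
    have hT0 : 0 ≤ T := Finset.sum_nonneg fun i _ =>
      mul_nonneg (Real.rpow_nonneg (hP i) _) (Real.rpow_nonneg (hQ i) _)
    constructor
    · intro h g hg
      have hconj : a.HolderConjugate β⁻¹ := by
        rw [Real.holderConjugate_iff]
        refine ⟨ha, ?_⟩
        rw [inv_inv, hβ]; ring
      have hold := Real.inner_le_Lp_mul_Lq_of_nonneg Finset.univ hconj
        (f := fun i => P i * Q i ^ (-β)) (g := fun i => (Q i * g i) ^ β)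
        (fun i _ => mul_nonneg (hP i) (Real.rpow_nonneg (hQ i) _))
        (fun i _ => Real.rpow_nonneg (mul_nonneg (hQ i) (hg i)) _)
      have e1 : ∀ i, P i * Q i ^ (-β) * (Q i * g i) ^ β = P i * g i ^ β := by
        intro i
        rcases (hQ i).eq_or_lt with hq | hq
        · rw [hac i hq.symm]; simp
        · rw [Real.mul_rpow hq.le (hg i), Real.rpow_neg hq.le]
          have : Q i ^ β ≠ 0 := (Real.rpow_pos_of_pos hq _).ne'
          field_simp
      have e2 : ∀ i, (P i * Q i ^ (-β)) ^ a = P i ^ a * Q i ^ (1 - a) := by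
        intro i
        rw [Real.mul_rpow (hP i) (Real.rpow_nonneg (hQ i) _), ← Real.rpow_mul (hQ i)]
        congr 2
        linarith
      have e3 : ∀ i, ((Q i * g i) ^ β) ^ (β⁻¹) = Q i * g i := by
        intro i
        rw [← Real.rpow_mul (mul_nonneg (hQ i) (hg i)), mul_inv_cancel₀ hβ0.ne', Real.rpow_one]
      simp only [e1, e2, e3, one_div, inv_inv] at hold
      refine hold.trans (mul_le_mul_of_nonneg_right ?_ (Real.rpow_nonneg
        (Finset.sum_nonneg fun i _ => mul_nonneg (hQ i) (hg i)) _))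
      refine (Real.rpow_le_rpow hT0 h (by positivity)).trans (le_of_eq ?_)
      rw [← Real.exp_mul, ← hab]
      congr 1
      field_simp
    · intro h
      -- At the Hölder extremizer both sums equal `T`, leaving `T ≤ exp (β r) * T ^ β`, that is, `T
      -- ^ (1 / a) ≤ exp (β r)`.
      have hg := h (fun i => (P i / Q i) ^ a) fun i =>
        Real.rpow_nonneg (div_nonneg (hP i) (hQ i)) _
      have e1 : ∀ i, P i * ((P i / Q i) ^ a) ^ β = P i ^ a * Q i ^ (1 - a) := by
        intro i
        rcases (hP i).eq_or_lt with hp | hp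
        · rw [← hp]; simp [Real.zero_rpow ha0.ne']
        · rw [← Real.rpow_mul (div_nonneg (hP i) (hQ i)), hab, Real.div_rpow (hP i) (hQ i),
            div_eq_mul_inv, ← Real.rpow_neg (hQ i), ← mul_assoc, neg_sub]
          congr 1
          rw [Real.rpow_sub_one hp.ne']
          field_simp
      have e2 : ∀ i, Q i * (P i / Q i) ^ a = P i ^ a * Q i ^ (1 - a) := by
        intro i
        rcases (hQ i).eq_or_lt with hq | hq
        · rw [hac i hq.symm]; simp [Real.zero_rpow ha0.ne', ← hq]
        · rw [Real.div_rpow (hP i) (hQ i), Real.rpow_sub hq, Real.rpow_one]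
          field_simp
      simp only [e1, e2] at hg
      rw [← hT] at hg
      rcases hT0.eq_or_lt with h0 | h0
      · rw [← h0]; positivity
      · have h2 : T ^ (a⁻¹) ≤ Real.exp (β * r) := by
          have : a⁻¹ = 1 - β := by rw [hβ]; ring
          rw [this, Real.rpow_sub h0, Real.rpow_one, div_le_iff₀ (Real.rpow_pos_of_pos h0 _)]
          exact hg
        have h3 := Real.rpow_le_rpow (Real.rpow_nonneg hT0 _) h2 ha0.le
        rw [← Real.rpow_mul hT0, inv_mul_cancel₀ ha0.ne', Real.rpow_one, ← Real.exp_mul] at h3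
        refine h3.trans (le_of_eq ?_)
        rw [← hab]; congr 1; ring
  · push Not at hac
    obtain ⟨i, hq, hp⟩ := hac
    have hp' : 0 < P i := (hP i).lt_of_ne hp.symm
    -- Without absolute continuity both sides fail: the sum has an infinite term, and the indicator
    -- of the offending point violates the inequality.
    refine iff_of_false ?_ ?_
    · rw [not_le]
      refine lt_of_lt_of_le ENNReal.ofReal_lt_top ?_
      refine le_trans ?_ (Finset.single_le_sum (fun _ _ => zero_le) (Finset.mem_univ i))
      rw [hq, ENNReal.ofReal_zero, ENNReal.zero_rpow_of_neg (by linarith), ENNReal.mul_top]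
      simp [ENNReal.rpow_eq_zero_iff, hp', ha0, not_lt.2 ha0.le]
    · intro h
      have := h (Pi.single i 1) fun j => by by_cases hj : j = i <;> simp [hj]
      have e1 : ∑ j, P j * (Pi.single i (1 : ℝ) : ι → ℝ) j ^ β = P i := by
        rw [Finset.sum_eq_single i]
        · simp
        · intro j _ hj; simp [hj, Real.zero_rpow hβ0.ne']
        · simp
      have e2 : ∑ j, Q j * (Pi.single i (1 : ℝ) : ι → ℝ) j = 0 := by
        simp [Pi.single_apply, hq]
      rw [e1, e2, Real.zero_rpow hβ0.ne', mul_zero] at this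
      linarith

/-- Variational characterization of the classical Rényi divergence. -/
theorem renyiDiv_le_iff {α : ℝ≥0∞} (h1 : 1 ≤ α) {P Q : ι → ℝ}
    (hP : ∀ i, 0 ≤ P i) (hQ : ∀ i, 0 ≤ Q i) (hP1 : α = 1 → ∑ i, P i = 1) (r : ℝ) :
    renyiDiv α P Q ≤ r ↔
      ∀ g : ι → ℝ, (∀ i, PhiDom (gainExponent α) (g i)) →
        ∑ i, P i * phi (gainExponent α) (g i) ≤ bnd (gainExponent α) r (∑ i, Q i * g i) := by
  rcases h1.eq_or_lt with rfl | h1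
  · simp only [renyiDiv_one_le_iff hP hQ (hP1 rfl), PhiDom, phi, bnd, gainExponent_one, if_true]
  · have h0 := (gainExponent_pos h1).ne'
    simp only [PhiDom, phi, bnd, h0, if_false]
    rcases eq_or_ne α ⊤ with rfl | ht
    · simp [renyiDiv_top_le_iff hP hQ, gainExponent_top]
    · exact renyiDiv_finite_le_iff h1 ht hP hQ r

end Classical

theorem IsPOVM.reindex {ι κ n : Type*} [Fintype ι] [Fintype κ] [Fintype n] [DecidableEq n]
    {E : ι → Matrix n n ℂ} (hE : IsPOVM E) (e : κ ≃ ι) : IsPOVM (E ∘ e) :=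
  ⟨fun k => hE.1 (e k), by rw [← hE.2]; exact Equiv.sum_comp e E⟩

/-- Variational characterization of the measured Rényi divergence. -/
theorem measuredDiv_le_iff {n : Type*} [Fintype n] [DecidableEq n] {α : ℝ≥0∞} (h1 : 1 ≤ α)
    {ρ σ : Matrix n n ℂ} (hρ : ρ.PosSemidef) (hσ : σ.PosSemidef)
    (htr : α = 1 → ρ.trace.re = 1) (r : ℝ) :
    measuredDiv α ρ σ ≤ r ↔ ∀ Ω : Matrix n n ℂ, MatDom (gainExponent α) Ω →
      trPair ρ (cfc (phi (gainExponent α)) Ω) ≤ bnd (gainExponent α) r (trPair σ Ω) := by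
  constructor
  · intro h Ω hΩ
    have hΩh := hΩ.posSemidef.isHermitian
    -- The spectral measurement of `Ω` turns the trace inequality into the classical one, with the
    -- eigenvalues as test function.
    obtain ⟨E, hE, hE1, hE2⟩ := exists_spectral_povm' hΩh
    let e := (Fintype.equivFin n).symm
    have hE' := hE.reindex e
    have h2 : renyiDiv α (fun i => trPair ρ ((E ∘ e) i)) (fun i => trPair σ ((E ∘ e) i))
        ≤ r := by
      refine le_trans ?_ h
      unfold measuredDiv
      exact le_iSup_of_le _ (le_iSup_of_le (E ∘ e) (le_iSup_of_le hE' le_rfl))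
    rw [renyiDiv_le_iff h1 (fun i => trPair_nonneg hρ (hE'.1 i))
      (fun i => trPair_nonneg hσ (hE'.1 i)) (fun ha => by
        rw [← htr ha]; exact hE'.sum_trPair ρ)] at h2
    have h3 := h2 (fun i => hΩh.eigenvalues (e i)) fun i => hΩ.phiDom_eigenvalues hΩh (e i)
    simp only [Function.comp_apply] at h3
    rw [Equiv.sum_comp e (fun i => trPair ρ (E i) * phi _ (hΩh.eigenvalues i)),
      Equiv.sum_comp e (fun i => trPair σ (E i) * hΩh.eigenvalues i)] at h3
    rw [hE2, show trPair σ Ω = _ from congrArg (trPair σ) hE1]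
    simpa only [trPair_sum, trPair_smul, mul_comm] using h3
  · intro h
    refine iSup_le fun k => iSup_le fun E => iSup_le fun hE => ?_
    refine (renyiDiv_le_iff h1 (fun i => trPair_nonneg hρ (hE.1 i))
      (fun i => trPair_nonneg hσ (hE.1 i)) (fun ha => by
        rw [← htr ha]; exact hE.sum_trPair ρ) r).2 ?_
    intro g hg
    -- An arbitrary POVM and test function are absorbed into the operator `∑ g i • E i`; Jensen says
    -- that this only increases the left side.
    have h2 := (trPair_mono hρ (cfc_phi_jensen (gainExponent_mem h1) hE hg)).trans
      (h _ (matDom_povm_sum hE hg))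
    simpa only [trPair_sum, trPair_smul, mul_comm] using h2

/-! ### Block-diagonal operators -/

section Blocks

variable {X B : Type*} [Fintype X] [DecidableEq X] [Fintype B] [DecidableEq B]

theorem cqOp_apply (τ : X → Matrix B B ℂ) (x y : X) (a b : B) :
    cqOp τ (x, a) (y, b) = if x = y then τ x a b else 0 := by
  rw [cqOp, Matrix.sum_apply]
  rw [Finset.sum_eq_single x]
  · by_cases h : x = y <;> simp [Matrix.kroneckerMap_apply, h]
  · intro z _ hz
    simp [Matrix.kroneckerMap_apply, hz]
  · simp

/-- The isometry `|x⟩ ⊗ 1`. -/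
noncomputable def blockIncl (x : X) : Matrix (X × B) B ℂ :=
  Matrix.of fun z b => if z = (x, b) then 1 else 0

/-- The diagonal block of `M` at `x`. -/
def block (M : Matrix (X × B) (X × B) ℂ) (x : X) : Matrix B B ℂ :=
  M.submatrix (fun b => (x, b)) fun b => (x, b)

theorem mul_blockIncl_apply {m : Type*} (M : Matrix m (X × B) ℂ) (x : X) (z : m) (b : B) :
    (M * (blockIncl x : Matrix (X × B) B ℂ)) z b = M z (x, b) := by
  simp [Matrix.mul_apply, blockIncl]

theorem blockIncl_mul_apply (A : Matrix B B ℂ) (x y : X) (a b : B) :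
    ((blockIncl x : Matrix (X × B) B ℂ) * A) (y, a) b = if y = x then A a b else 0 := by
  by_cases h : y = x <;> simp [Matrix.mul_apply, blockIncl, h]

theorem blockIncl_conj (M : Matrix (X × B) (X × B) ℂ) (x : X) :
    (blockIncl x : Matrix (X × B) B ℂ)ᴴ * M * (blockIncl x : Matrix (X × B) B ℂ) = block M x := by
  ext a b
  rw [mul_blockIncl_apply]
  simp [Matrix.mul_apply, Matrix.conjTranspose_apply, blockIncl, block,
    apply_ite (star : ℂ → ℂ)]

theorem blockIncl_isometry (x : X) :
    (blockIncl x : Matrix (X × B) B ℂ)ᴴ * (blockIncl x : Matrix (X × B) B ℂ) = 1 := by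
  have := blockIncl_conj (1 : Matrix (X × B) (X × B) ℂ) x
  rw [Matrix.mul_one] at this
  rw [this]
  ext a b
  by_cases h : a = b <;> simp [block, Matrix.one_apply, h]

theorem cqOp_mul (τ κ : X → Matrix B B ℂ) : cqOp τ * cqOp κ = cqOp fun x => τ x * κ x := by
  ext ⟨x, a⟩ ⟨y, b⟩
  rw [Matrix.mul_apply, Fintype.sum_prod_type, cqOp_apply, Finset.sum_eq_single x]
  · by_cases h : x = y <;> simp [cqOp_apply, h, Matrix.mul_apply]
  · intro z _ hz
    simp [cqOp_apply, hz.symm]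
  · simp

theorem cqOp_one : cqOp (fun _ : X => (1 : Matrix B B ℂ)) = 1 := by
  ext ⟨x, a⟩ ⟨y, b⟩
  by_cases h : x = y <;> by_cases h' : a = b <;> simp [cqOp_apply, Matrix.one_apply, h, h']

theorem cqOp_posSemidef {τ : X → Matrix B B ℂ} (h : ∀ x, (τ x).PosSemidef) :
    (cqOp τ).PosSemidef := by
  refine posSemidef_sum _ fun x _ => PosSemidef.kronecker ?_ (h x)
  rw [← Matrix.diagonal_single]
  refine PosSemidef.diagonal fun y => ?_
  by_cases hy : y = x <;> simp [hy]

theorem cqOp_matDom {β : ℝ} {τ : X → Matrix B B ℂ} (h : ∀ x, MatDom β (τ x)) :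
    MatDom β (cqOp τ) := by
  have hp := cqOp_posSemidef fun x => (h x).posSemidef
  unfold MatDom at *
  split_ifs at *
  · rw [hp.posDef_iff_isUnit]
    have : cqOp τ * cqOp (fun x => (τ x)⁻¹) = 1 := by
      rw [cqOp_mul, ← cqOp_one]
      congr 1
      funext x
      exact Matrix.mul_nonsing_inv _ ((Matrix.isUnit_iff_isUnit_det _).1 (h x).isUnit)
    exact IsUnit.of_mul_eq_one _ this
  · exact hp

/-- The block inclusion intertwines the block-diagonal operator with its block, so the calculus acts
blockwise. -/
theorem cfc_cqOp {τ : X → Matrix B B ℂ} (h : ∀ x, (τ x).IsHermitian) (f : ℝ → ℝ) :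
    cfc f (cqOp τ) = cqOp fun x => cfc f (τ x) := by
  have hh : (cqOp τ).IsHermitian := by
    ext ⟨x, a⟩ ⟨y, b⟩
    rw [Matrix.conjTranspose_apply, cqOp_apply, cqOp_apply]
    by_cases hxy : y = x
    · subst hxy; simpa using (h y).apply a b
    · simp [hxy, Ne.symm hxy]
  ext ⟨y, a⟩ ⟨x, b⟩
  have key := cfc_mul_of_intertwine hh (h x) (V := blockIncl x) (by
    ext ⟨z, c⟩ d
    rw [mul_blockIncl_apply, blockIncl_mul_apply, cqOp_apply]
    by_cases hz : z = x <;> simp [hz]) f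
  have := congrFun (congrFun key (y, a)) b
  rw [mul_blockIncl_apply, blockIncl_mul_apply] at this
  rw [this, cqOp_apply]
  by_cases hz : y = x <;> simp [hz]

theorem trPair_cqOp (τ : X → Matrix B B ℂ) (M : Matrix (X × B) (X × B) ℂ) :
    trPair (cqOp τ) M = ∑ x, trPair (τ x) (block M x) := by
  simp only [trPair, ← Complex.re_sum]
  congr 1
  rw [Matrix.trace, Fintype.sum_prod_type]
  refine Finset.sum_congr rfl fun x _ => ?_
  rw [Matrix.trace]
  refine Finset.sum_congr rfl fun a _ => ?_
  simp only [Matrix.diag_apply, Matrix.mul_apply]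
  rw [Fintype.sum_prod_type, Finset.sum_eq_single x]
  · simp [cqOp_apply, block]
  · intro z _ hz
    simp [cqOp_apply, hz.symm]
  · simp

theorem block_cqOp (τ : X → Matrix B B ℂ) (x : X) : block (cqOp τ) x = τ x := by
  ext a b; simp [block, cqOp_apply]

theorem MatDom.block {β : ℝ} {M : Matrix (X × B) (X × B) ℂ} (h : MatDom β M) (x : X) :
    MatDom β (block M x) := by
  unfold MatDom at *
  split_ifs at *
  · exact h.submatrix (Prod.mk_right_injective x)
  · exact h.submatrix _

theorem block_cfc_phi_le {β : ℝ} (hβ : β ∈ Set.Icc (0 : ℝ) 1) {M : Matrix (X × B) (X × B) ℂ}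
    (h : MatDom β M) (x : X) : block (cfc (phi β) M) x ≤ cfc (phi β) (block M x) := by
  rw [← blockIncl_conj, ← blockIncl_conj]
  exact cfc_phi_compression hβ h (blockIncl_isometry x)

theorem trace_cqOp (τ : X → Matrix B B ℂ) : (cqOp τ).trace.re = ∑ x, classicalMarginal τ x := by
  have := trPair_cqOp τ 1
  rw [trPair_one] at this
  rw [this]
  refine Finset.sum_congr rfl fun x _ => ?_
  have : block (1 : Matrix (X × B) (X × B) ℂ) x = 1 := by rw [← cqOp_one, block_cqOp]
  rw [this, trPair_one, classicalMarginal]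

/-- Variational characterization of the measured Rényi divergence of block-diagonal operators. -/
theorem measuredDiv_cqOp_le_iff {α : ℝ≥0∞} (h1 : 1 ≤ α)
    {τ κ : X → Matrix B B ℂ} (hτ : ∀ x, (τ x).PosSemidef) (hκ : ∀ x, (κ x).PosSemidef)
    (htr : α = 1 → ∑ x, classicalMarginal τ x = 1) (r : ℝ) :
    measuredDiv α (cqOp τ) (cqOp κ) ≤ r ↔
      ∀ Ω : X → Matrix B B ℂ, (∀ x, MatDom (gainExponent α) (Ω x)) →
        ∑ x, trPair (τ x) (cfc (phi (gainExponent α)) (Ω x)) ≤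
          bnd (gainExponent α) r (∑ x, trPair (κ x) (Ω x)) := by
  rw [measuredDiv_le_iff h1 (cqOp_posSemidef hτ) (cqOp_posSemidef hκ)
    (fun ha => by rw [trace_cqOp, htr ha])]
  constructor
  · intro h Ω hΩ
    have := h (cqOp Ω) (cqOp_matDom hΩ)
    rw [cfc_cqOp fun x => (hΩ x).posSemidef.isHermitian] at this
    simpa only [trPair_cqOp, block_cqOp] using this
  · intro h Ω hΩ
    have h2 := h (fun x => block Ω x) fun x => hΩ.block x
    rw [trPair_cqOp, trPair_cqOp]
    -- Discarding the off-diagonal blocks of `Ω` leaves the right side unchanged and, by the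
    -- compression inequality, does not decrease the left.
    exact le_trans (Finset.sum_le_sum fun x _ =>
      trPair_mono (hτ x) (block_cfc_phi_le (gainExponent_mem h1) hΩ x)) h2

theorem one_kronecker_eq_cqOp (σ : Matrix B B ℂ) :
    (1 : Matrix X X ℂ) ⊗ₖ σ = cqOp fun _ => σ := by
  ext ⟨x, a⟩ ⟨y, b⟩
  by_cases h : x = y <;> simp [cqOp_apply, Matrix.kroneckerMap_apply, h]

theorem marginalOp_kronecker_eq_cqOp (τ : X → Matrix B B ℂ) (σ : Matrix B B ℂ) :
    marginalOp τ ⊗ₖ σ = cqOp fun x => (classicalMarginal τ x : ℂ) • σ := by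
  ext ⟨x, a⟩ ⟨y, b⟩
  by_cases h : x = y <;>
    simp [cqOp_apply, Matrix.kroneckerMap_apply, marginalOp, h]

end Blocks

/-! ### Compactness of density operators and minimax -/

section Density

variable {B : Type*} [Fintype B] [DecidableEq B]

theorem continuous_trPair_left (A : Matrix B B ℂ) : Continuous fun σ : Matrix B B ℂ => trPair σ A := by
  unfold trPair
  fun_prop

/-- The density operators are the image of the Frobenius unit sphere under `S ↦ Sᴴ * S`. -/
theorem isCompact_density : IsCompact {σ : Matrix B B ℂ | IsDensity σ} := by
  have htr : ∀ S : Matrix B B ℂ, (Sᴴ * S).trace = ((∑ j, ∑ i, ‖S i j‖ ^ 2 : ℝ) : ℂ) := by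
    intro S
    simp only [Matrix.trace, Matrix.diag_apply, Matrix.mul_apply, Matrix.conjTranspose_apply]
    push_cast
    refine Finset.sum_congr rfl fun j _ => Finset.sum_congr rfl fun i _ => ?_
    exact Complex.conj_mul' (S i j)
  set C : Set (Matrix B B ℂ) := {S | ∑ j, ∑ i, ‖S i j‖ ^ 2 = (1 : ℝ)}
  have hC : IsCompact C := by
    refine IsCompact.of_isClosed_subset (s := Set.pi Set.univ fun _ : B => Set.pi Set.univ
      fun _ : B => Metric.closedBall (0 : ℂ) 1)
      (isCompact_univ_pi fun i => isCompact_univ_pi fun j => isCompact_closedBall 0 1) ?_ ?_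
    · refine isClosed_eq ?_ continuous_const
      refine continuous_finsetSum _ fun j _ => continuous_finsetSum _ fun i _ => ?_
      exact ((continuous_id.matrix_elem i j).norm).pow 2
    · intro S hS i _ j _
      rw [mem_closedBall_zero_iff]
      have h1 : ‖S i j‖ ^ 2 ≤ 1 := by
        rw [← show ∑ j, ∑ i, ‖S i j‖ ^ 2 = (1 : ℝ) from hS]
        refine le_trans ?_ (Finset.single_le_sum (f := fun j => ∑ i, ‖S i j‖ ^ 2)
          (fun _ _ => Finset.sum_nonneg fun _ _ => by positivity) (Finset.mem_univ j))
        exact Finset.single_le_sum (f := fun i => ‖S i j‖ ^ 2) (fun _ _ => by positivity)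
          (Finset.mem_univ i)
      exact (sq_le_one_iff₀ (norm_nonneg _)).1 h1
  have himg : {σ : Matrix B B ℂ | IsDensity σ} = (fun S => Sᴴ * S) '' C := by
    ext σ
    constructor
    · rintro ⟨h1, h2⟩
      obtain ⟨S, rfl⟩ := CStarAlgebra.nonneg_iff_eq_star_mul_self.mp h1.nonneg
      refine ⟨S, ?_, rfl⟩
      rw [star_eq_conjTranspose, htr] at h2
      exact_mod_cast h2
    · rintro ⟨S, hS, rfl⟩
      refine ⟨posSemidef_conjTranspose_mul_self S, ?_⟩
      rw [htr, show ∑ j, ∑ i, ‖S i j‖ ^ 2 = (1 : ℝ) from hS]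
      simp
  rw [himg]
  exact hC.image (by fun_prop)

theorem convex_density : Convex ℝ {σ : Matrix B B ℂ | IsDensity σ} := by
  intro ρ hρ σ hσ s t hs ht hst
  refine ⟨(hρ.1.smul hs).add (hσ.1.smul ht), ?_⟩
  rw [Matrix.trace_add, Matrix.trace_smul, Matrix.trace_smul, hρ.2, hσ.2]
  simp only [Complex.real_smul, mul_one]
  exact_mod_cast hst

theorem exists_density [Nonempty B] : ∃ σ : Matrix B B ℂ, IsDensity σ := by
  refine ⟨((Fintype.card B : ℝ)⁻¹) • 1, PosSemidef.one.smul (by positivity), ?_⟩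
  rw [Matrix.trace_smul, Matrix.trace_one, Complex.real_smul]
  push_cast
  exact inv_mul_cancel₀ (by simp)

/-- Minimax theorem for families of affine functions on the set of density operators. -/
theorem exists_weights_of_forall_density [Nonempty B] {I : Type*} (N : I → Matrix B B ℂ) (c : I → ℝ)
    (h : ∀ σ : Matrix B B ℂ, IsDensity σ → ∃ i, trPair σ (N i) < c i) :
    ∃ (s : Finset I) (w : I → ℝ), (∀ i ∈ s, 0 ≤ w i) ∧ ∑ i ∈ s, w i = 1 ∧
      ∀ σ : Matrix B B ℂ, IsDensity σ → ∑ i ∈ s, w i * trPair σ (N i) < ∑ i ∈ s, w i * c i := by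
  classical
  -- The strict violations are open in `σ`; compactness leaves finitely many indices, so the weights
  -- range over a compact simplex.
  obtain ⟨s, hs⟩ := isCompact_density.elim_finite_subcover
    (fun i => {σ : Matrix B B ℂ | trPair σ (N i) < c i})
    (fun i => isOpen_lt (continuous_trPair_left _) continuous_const)
    (fun σ hσ => by simpa using h σ hσ)
  obtain ⟨σ₀, hσ₀⟩ := exists_density (B := B)
  have hsne : Nonempty s := by
    have := hs hσ₀
    simp only [Set.mem_iUnion] at this
    obtain ⟨i, hi, _⟩ := this
    exact ⟨⟨i, hi⟩⟩
  let f : Matrix B B ℂ → (s → ℝ) → ℝ := fun σ w => ∑ i, w i * (c i - trPair σ (N i))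
  have hlin : ∀ A : Matrix B B ℂ, IsLinearMap ℝ fun σ : Matrix B B ℂ => trPair σ A := fun A =>
    ⟨fun x y => by simp [trPair_comm _ A, trPair_add], fun t x => by
      simp [trPair_comm _ A, trPair_smul]⟩
  have hconv : ∀ w ∈ stdSimplex ℝ s, ConvexOn ℝ {σ : Matrix B B ℂ | IsDensity σ}
      (fun σ => f σ w) := by
    intro w hw
    refine ⟨convex_density, fun ρ _ σ _ t u _ _ htu => le_of_eq ?_⟩
    simp only [f, smul_eq_mul, (hlin _).map_add, (hlin _).map_smul, Finset.mul_sum,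
      ← Finset.sum_add_distrib]
    refine Finset.sum_congr rfl fun i _ => ?_
    have : u = 1 - t := by linarith
    subst this
    ring
  have hconc : ∀ σ ∈ {σ : Matrix B B ℂ | IsDensity σ}, ConcaveOn ℝ (stdSimplex ℝ s) (f σ) := by
    intro σ _
    refine ⟨convex_stdSimplex ℝ s, fun w _ w' _ t u _ _ htu => le_of_eq ?_⟩
    simp only [f, smul_eq_mul, Finset.mul_sum, ← Finset.sum_add_distrib, Pi.add_apply,
      Pi.smul_apply]
    exact Finset.sum_congr rfl fun i _ => by ring
  have hcont1 : ∀ w, Continuous fun σ => f σ w := fun w =>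
    continuous_finsetSum _ fun i _ => continuous_const.mul
      (continuous_const.sub (continuous_trPair_left _))
  have hcont2 : ∀ σ, Continuous (f σ) := fun σ => by fun_prop
  obtain ⟨σ, hσ, w, hw, hsad⟩ := Sion.exists_isSaddlePointOn (f := f)
    (X := {σ : Matrix B B ℂ | IsDensity σ}) (Y := stdSimplex ℝ s)
    ⟨σ₀, hσ₀⟩ convex_density isCompact_density
    (fun w hw => (hcont1 w).lowerSemicontinuous.lowerSemicontinuousOn _)
    (fun w hw => (hconv w hw).quasiconvexOn)
    (convex_stdSimplex ℝ s) ⟨Pi.single (Classical.arbitrary s) 1, single_mem_stdSimplex ℝ _⟩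
    (isCompact_stdSimplex ℝ s)
    (fun σ hσ => (hcont2 σ).upperSemicontinuous.upperSemicontinuousOn _)
    (fun σ hσ => (hconc σ hσ).quasiconcaveOn)
  obtain ⟨i, hi⟩ : ∃ i : s, trPair σ (N i) < c i := by
    have := hs hσ
    simp only [Set.mem_iUnion] at this
    obtain ⟨i, hi, h⟩ := this
    exact ⟨⟨i, hi⟩, h⟩
  -- Some index is strictly violated at the saddle point `σ`; the saddle inequality carries this
  -- positivity to the weights `w` at every other density operator.
  have hpos : 0 < f σ (Pi.single i 1) := by
    have : f σ (Pi.single i 1) = c i - trPair σ (N i) := by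
      simp only [f]
      rw [Finset.sum_eq_single i]
      · simp
      · intro j _ hj; simp [hj]
      · simp
    linarith
  refine ⟨s, fun i => if h : i ∈ s then w ⟨i, h⟩ else 0, fun i hi => ?_, ?_, fun σ' hσ' => ?_⟩
  · simpa [hi] using hw.1 ⟨i, hi⟩
  · rw [← Finset.sum_coe_sort, ← hw.2]
    exact Finset.sum_congr rfl fun i _ => by simp
  · have h1 := hpos.trans_le (hsad σ' hσ' _ (single_mem_stdSimplex ℝ i))
    rw [← Finset.sum_coe_sort, ← Finset.sum_coe_sort s, ← sub_pos, ← Finset.sum_sub_distrib]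
    refine h1.trans_le (le_of_eq (Finset.sum_congr rfl fun i _ => ?_))
    simp [mul_sub]

end Density

/-! ### Behaviour of the test function under scaling -/

section Scaling

variable {n : Type*} [Fintype n] [DecidableEq n]

theorem cfc_phi_smul_zero {A : Matrix n n ℂ} (hA : A.PosDef) {c : ℝ} (hc : 0 < c) :
    cfc (phi 0) (c • A) = Real.log c • (1 : Matrix n n ℂ) + cfc (phi 0) A := by
  have hh : IsSelfAdjoint A := hA.isHermitian
  have h1 : cfc (phi 0) (c • A) = cfc (fun t => phi 0 (c • t)) A :=
    (cfc_comp_smul c (phi 0) A ((Matrix.finite_real_spectrum.image _).continuousOn _) hh).symm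
  have h2 : cfc (fun t => phi 0 (c • t)) A = cfc (fun t => Real.log c + phi 0 t) A := by
    refine cfc_congr fun t ht => ?_
    rw [hA.isHermitian.spectrum_real_eq_range_eigenvalues] at ht
    obtain ⟨i, rfl⟩ := ht
    simp only [phi_zero, smul_eq_mul]
    exact Real.log_mul hc.ne' (hA.eigenvalues_pos i).ne'
  have h3 : cfc (fun t => Real.log c + phi 0 t) A =
      cfc (fun _ => Real.log c) A + cfc (phi 0) A :=
    cfc_add A (fun _ => Real.log c) (phi 0) (continuousOn_spectrum _ _) (continuousOn_spectrum _ _)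
  have h4 : cfc (fun _ => Real.log c) A = algebraMap ℝ (Matrix n n ℂ) (Real.log c) :=
    cfc_const (Real.log c) A hh
  rw [h1, h2, h3, h4, Algebra.algebraMap_eq_smul_one]

theorem cfc_phi_smul_of_ne {β : ℝ} (hβ : β ≠ 0) {A : Matrix n n ℂ} (hA : A.PosSemidef) {c : ℝ}
    (hc : 0 ≤ c) : cfc (phi β) (c • A) = c ^ β • cfc (phi β) A := by
  have hh : IsSelfAdjoint A := hA.isHermitian
  have h1 : cfc (phi β) (c • A) = cfc (fun t => phi β (c • t)) A :=
    (cfc_comp_smul c (phi β) A ((Matrix.finite_real_spectrum.image _).continuousOn _) hh).symm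
  have h2 : cfc (fun t => phi β (c • t)) A = cfc (fun t => c ^ β * phi β t) A := by
    refine cfc_congr fun t ht => ?_
    rw [hA.isHermitian.spectrum_real_eq_range_eigenvalues] at ht
    obtain ⟨i, rfl⟩ := ht
    simp only [phi_of_ne hβ, smul_eq_mul]
    exact Real.mul_rpow hc (hA.eigenvalues_nonneg i)
  rw [h1, h2]
  exact cfc_const_mul (c ^ β) (phi β) A (continuousOn_spectrum _ _)

end Scaling

/-! ### One test family for all density operators -/

section Minimax

variable {X B : Type*} [Fintype X] [DecidableEq X] [Fintype B] [DecidableEq B]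

/-- Slope of the affine majorant of `bnd β r` that is tight at normalized arguments. -/
noncomputable def bndSlope (β r : ℝ) : ℝ := if β = 0 then 1 else Real.exp (β * r) * β

/-- Constant term of the affine majorant of `bnd β r` that is tight at normalized arguments. -/
noncomputable def bndConst (β r : ℝ) : ℝ := if β = 0 then r - 1 else Real.exp (β * r) * (1 - β)

theorem bndSlope_pos {β : ℝ} (hβ : 0 ≤ β) (r : ℝ) : 0 < bndSlope β r := by
  unfold bndSlope
  split_ifs with h
  · exact one_pos
  · have : 0 < β := hβ.lt_of_ne (Ne.symm h)
    positivity

/-- The majorant is the tangent at `s = 1`, so this is Bernoulli's inequality; for `β = 0` the two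
sides coincide. -/
theorem bnd_le_affine {β : ℝ} (hβ : β ∈ Set.Icc (0 : ℝ) 1) (r : ℝ) {s : ℝ} (hs : 0 ≤ s) :
    bnd β r s ≤ bndSlope β r * s + bndConst β r := by
  unfold bnd bndSlope bndConst
  split_ifs with h
  · linarith
  · have h1 : s ^ β ≤ β * s + (1 - β) := by
      have := rpow_one_add_le_one_add_mul_self (s := s - 1) (by linarith) hβ.1 hβ.2
      rw [add_sub_cancel] at this
      linarith
    have := mul_le_mul_of_nonneg_left h1 (Real.exp_pos (β * r)).le
    linarith

/-- A strict violation of the bound `bnd β r` becomes a strict violation of its affine majorant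
after rescaling. -/
theorem exists_scale {β : ℝ} (hβ : 0 ≤ β) {r v s : ℝ} (hs : 0 ≤ s) (h : bnd β r s < v) :
    ∃ c : ℝ, 0 < c ∧ (β = 0 → c = 1) ∧
      bndSlope β r * (c * s) + bndConst β r < (if β = 0 then v else c ^ β * v) := by
  unfold bnd at h
  unfold bndSlope bndConst
  by_cases h0 : β = 0
  · simp only [h0, if_true] at *
    exact ⟨1, one_pos, fun _ => rfl, by linarith⟩
  · simp only [if_neg h0] at *
    have hβ' : 0 < β := hβ.lt_of_ne (Ne.symm h0)
    rcases hs.eq_or_lt with rfl | hs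
    · rw [Real.zero_rpow h0, mul_zero] at h
      -- At `s = 0` scaling is free on the right; this factor makes `c ^ β * v` exceed the constant
      -- term by at least one.
      refine ⟨((1 + |Real.exp (β * r) * (1 - β)|) / v) ^ β⁻¹, by positivity, fun hh => absurd hh h0, ?_⟩
      rw [← Real.rpow_mul (by positivity), inv_mul_cancel₀ h0, Real.rpow_one,
        div_mul_cancel₀ _ h.ne']
      have := le_abs_self (Real.exp (β * r) * (1 - β))
      linarith
    -- Scaling moves the argument to `1`, where the tangent touches `bnd β r`.
    · refine ⟨s⁻¹, by positivity, fun hh => absurd hh h0, ?_⟩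
      rw [inv_mul_cancel₀ hs.ne', Real.inv_rpow hs.le, inv_mul_eq_div,
        lt_div_iff₀ (Real.rpow_pos_of_pos hs _)]
      refine lt_of_eq_of_lt ?_ h
      ring

/-- This exchanges the quantifiers over `σ` and `Ω`. After rescaling, violations are affine in `σ`,
so the minimax theorem gives a mixture good for all `σ`; operator concavity of φ allows the mixture
to be replaced by its average. -/
theorem exists_uniform_family [Nonempty B] {β : ℝ} (hβ : β ∈ Set.Icc (0 : ℝ) 1)
    {τ : X → Matrix B B ℂ} (hτ : ∀ x, (τ x).PosSemidef) (r : ℝ)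
    (h : ∀ σ : Matrix B B ℂ, IsDensity σ → ∃ Ω : X → Matrix B B ℂ, (∀ x, MatDom β (Ω x)) ∧
      bnd β r (∑ x, trPair σ (Ω x)) < ∑ x, trPair (τ x) (cfc (phi β) (Ω x))) :
    ∃ Ω : X → Matrix B B ℂ, (∀ x, MatDom β (Ω x)) ∧ ∀ σ : Matrix B B ℂ, IsDensity σ →
      bndSlope β r * (∑ x, trPair σ (Ω x)) + bndConst β r <
        ∑ x, trPair (τ x) (cfc (phi β) (Ω x)) := by
  let I := {Ω : X → Matrix B B ℂ // ∀ x, MatDom β (Ω x)}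
  obtain ⟨s, w, hw0, hw1, hw⟩ := exists_weights_of_forall_density (I := I)
    (fun Ω => bndSlope β r • ∑ x, Ω.1 x)
    (fun Ω => ∑ x, trPair (τ x) (cfc (phi β) (Ω.1 x)) - bndConst β r) (by
      intro σ hσ
      obtain ⟨Ω, hΩ, hlt⟩ := h σ hσ
      obtain ⟨c, hc, hc1, hlt'⟩ := exists_scale hβ.1
        (Finset.sum_nonneg fun x _ => trPair_nonneg hσ.1 (hΩ x).posSemidef) hlt
      refine ⟨⟨fun x => c • Ω x, fun x => (hΩ x).smul hc⟩, ?_⟩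
      simp only [trPair_smul, trPair_sum, ← Finset.mul_sum]
      rw [lt_sub_iff_add_lt]
      refine hlt'.trans_le (le_of_eq ?_)
      split_ifs with h0
      · rw [hc1 h0]; simp
      · rw [Finset.mul_sum]
        refine Finset.sum_congr rfl fun x _ => ?_
        rw [cfc_phi_smul_of_ne h0 (hΩ x).posSemidef hc.le, trPair_smul])
  refine ⟨fun x => ∑ i ∈ s, w i • i.1 x, fun x =>
    (convex_matDom β).sum_mem hw0 hw1 fun i _ => i.2 x, fun σ hσ => ?_⟩
  have h1 := hw σ hσ
  have h2 : ∀ x, ∑ i ∈ s, w i * trPair (τ x) (cfc (phi β) (i.1 x)) ≤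
      trPair (τ x) (cfc (phi β) (∑ i ∈ s, w i • i.1 x)) := by
    intro x
    have := trPair_mono (hτ x) ((concaveOn_cfc_phi hβ).le_map_sum hw0 hw1 fun i _ => i.2 x)
    simpa only [trPair_sum, trPair_smul] using this
  have h3 := Finset.sum_le_sum fun x (_ : x ∈ Finset.univ) => h2 x
  rw [Finset.sum_comm] at h3
  simp only [mul_sub, Finset.sum_sub_distrib, ← Finset.sum_mul, hw1, one_mul, trPair_smul,
    trPair_sum] at h1
  simp only [← Finset.mul_sum] at h3
  have h4 : ∑ x, trPair σ (∑ i ∈ s, w i • i.1 x) = ∑ i ∈ s, w i * ∑ x, trPair σ (i.1 x) := by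
    simp only [trPair_sum, trPair_smul, Finset.mul_sum]
    exact Finset.sum_comm
  have h5 : ∑ i ∈ s, w i * (bndSlope β r * ∑ x, trPair σ (i.1 x)) =
      bndSlope β r * ∑ i ∈ s, w i * ∑ x, trPair σ (i.1 x) := by
    rw [Finset.mul_sum]
    exact Finset.sum_congr rfl fun i _ => by ring
  rw [h5] at h1
  rw [h4]
  linarith

/-- The same exchange with the input symbol as part of the index: the total weight on `x` becomes
the input probability `q x`, and only operators attached to the same `x` are averaged. -/
theorem exists_uniform_channel [Nonempty B] {β : ℝ} (hβ : β ∈ Set.Icc (0 : ℝ) 1)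
    {ρ : X → Matrix B B ℂ} (hρ : ∀ x, (ρ x).PosSemidef) (r : ℝ)
    (h : ∀ σ : Matrix B B ℂ, IsDensity σ → ∃ (x : X) (Ω : Matrix B B ℂ), MatDom β Ω ∧
      bnd β r (trPair σ Ω) < trPair (ρ x) (cfc (phi β) Ω)) :
    ∃ q ∈ stdSimplex ℝ X, ∃ Ω : X → Matrix B B ℂ, (∀ x, MatDom β (Ω x)) ∧
      ∀ σ : Matrix B B ℂ, IsDensity σ →
        bndSlope β r * (∑ x, q x * trPair σ (Ω x)) + bndConst β r <
          ∑ x, q x * trPair (ρ x) (cfc (phi β) (Ω x)) := by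
  let I := X × {Ω : Matrix B B ℂ // MatDom β Ω}
  obtain ⟨s, w, hw0, hw1, hw⟩ := exists_weights_of_forall_density (I := I)
    (fun i => bndSlope β r • i.2.1)
    (fun i => trPair (ρ i.1) (cfc (phi β) i.2.1) - bndConst β r) (by
      intro σ hσ
      obtain ⟨x, Ω, hΩ, hlt⟩ := h σ hσ
      obtain ⟨c, hc, hc1, hlt'⟩ := exists_scale hβ.1 (trPair_nonneg hσ.1 hΩ.posSemidef) hlt
      refine ⟨⟨x, c • Ω, hΩ.smul hc⟩, ?_⟩
      simp only [trPair_smul]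
      rw [lt_sub_iff_add_lt]
      refine hlt'.trans_le (le_of_eq ?_)
      split_ifs with h0
      · rw [hc1 h0]; simp
      · rw [cfc_phi_smul_of_ne h0 hΩ.posSemidef hc.le, trPair_smul])
  let q : X → ℝ := fun x => ∑ i ∈ s with i.1 = x, w i
  have hq0 : ∀ x, 0 ≤ q x := fun x => Finset.sum_nonneg fun i hi => hw0 i (Finset.mem_filter.1 hi).1
  have hq1 : ∑ x, q x = 1 := by
    rw [← hw1]
    exact Finset.sum_fiberwise s (fun i => i.1) w
  have hmerge : ∀ x, ∃ Ω : Matrix B B ℂ, MatDom β Ω ∧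
      (∀ σ, q x * trPair σ Ω = ∑ i ∈ s with i.1 = x, w i * trPair σ i.2.1) ∧
      ∑ i ∈ s with i.1 = x, w i * trPair (ρ x) (cfc (phi β) i.2.1) ≤
        q x * trPair (ρ x) (cfc (phi β) Ω) := by
    intro x
    rcases (hq0 x).eq_or_lt with h0 | h0
    · have hz : ∀ i ∈ s.filter (fun i => i.1 = x), w i = 0 :=
        (Finset.sum_eq_zero_iff_of_nonneg fun i hi => hw0 i (Finset.mem_filter.1 hi).1).1 h0.symm
      refine ⟨1, MatDom.of_posDef PosDef.one, fun σ => ?_, ?_⟩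
      · rw [← h0, zero_mul]
        exact (Finset.sum_eq_zero fun i hi => by rw [hz i hi, zero_mul]).symm
      · rw [← h0, zero_mul]
        exact (Finset.sum_eq_zero fun i hi => by rw [hz i hi, zero_mul]).le
    · have hv0 : ∀ i ∈ s.filter (fun i => i.1 = x), 0 ≤ w i / q x := fun i hi =>
        div_nonneg (hw0 i (Finset.mem_filter.1 hi).1) h0.le
      have hv1 : ∑ i ∈ s with i.1 = x, w i / q x = 1 := by
        rw [← Finset.sum_div]; exact div_self h0.ne'
      refine ⟨∑ i ∈ s with i.1 = x, (w i / q x) • i.2.1,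
        (convex_matDom β).sum_mem hv0 hv1 fun i _ => i.2.2, fun σ => ?_, ?_⟩
      · simp only [trPair_sum, trPair_smul, Finset.mul_sum]
        refine Finset.sum_congr rfl fun i _ => ?_
        field_simp
      · have := trPair_mono (hρ x) ((concaveOn_cfc_phi hβ).le_map_sum hv0 hv1 fun i _ => i.2.2)
        simp only [trPair_sum, trPair_smul] at this
        refine le_trans (le_of_eq ?_) (mul_le_mul_of_nonneg_left this h0.le)
        rw [Finset.mul_sum]
        refine Finset.sum_congr rfl fun i _ => ?_
        field_simp
  choose Ω hΩ h1 h2 using hmerge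
  refine ⟨q, ⟨hq0, hq1⟩, Ω, hΩ, fun σ hσ => ?_⟩
  have h3 := hw σ hσ
  simp only [mul_sub, Finset.sum_sub_distrib, ← Finset.sum_mul, hw1, one_mul, trPair_smul] at h3
  simp only [h1]
  rw [Finset.sum_fiberwise s (fun i => i.1) (fun i => w i * trPair σ i.2.1)]
  have h4 := Finset.sum_le_sum fun x (_ : x ∈ Finset.univ) => h2 x
  have h5 : ∑ x, ∑ i ∈ s with i.1 = x, w i * trPair (ρ x) (cfc (phi β) i.2.1) =
      ∑ i ∈ s, w i * trPair (ρ i.1) (cfc (phi β) i.2.1) := by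
    rw [← Finset.sum_fiberwise s (fun i => i.1)]
    refine Finset.sum_congr rfl fun x _ => Finset.sum_congr rfl fun i hi => ?_
    rw [(Finset.mem_filter.1 hi).2]
  have h6 : ∑ i ∈ s, w i * (bndSlope β r * trPair σ i.2.1) =
      bndSlope β r * ∑ i ∈ s, w i * trPair σ i.2.1 := by
    rw [Finset.mul_sum]
    exact Finset.sum_congr rfl fun i _ => by ring
  rw [h5] at h4
  rw [h6] at h3
  linarith

end Minimax

/-! ### From test families to POVMs -/

section Povm

variable {X B : Type*} [Fintype X] [DecidableEq X] [Fintype B] [DecidableEq B]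

/-- A maximizer of `Tr σ M` exists by compactness, and comparison with normalized rank-one
projections shows that the maximum dominates the quadratic form of `M`. -/
theorem exists_density_le_smul_one [Nonempty B] {M : Matrix B B ℂ} (hM : M.PosSemidef) :
    ∃ σ : Matrix B B ℂ, IsDensity σ ∧ M ≤ trPair σ M • (1 : Matrix B B ℂ) := by
  obtain ⟨σ, hσ, hmax⟩ := isCompact_density.exists_isMaxOn (exists_density (B := B))
    (continuous_trPair_left M).continuousOn
  refine ⟨σ, hσ, ?_⟩
  rw [Matrix.le_iff]
  refine PosSemidef.of_dotProduct_mulVec_nonneg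
    ((isHermitian_one.smul (IsSelfAdjoint.all _)).sub hM.isHermitian) fun v => ?_
  set t : ℝ := ∑ i, ‖v i‖ ^ 2 with ht
  have hvv : star v ⬝ᵥ v = (t : ℂ) := by
    rw [ht, dotProduct]
    push_cast
    exact Finset.sum_congr rfl fun i _ => Complex.conj_mul' (v i)
  have ht0 : 0 ≤ t := Finset.sum_nonneg fun i _ => by positivity
  have hre : star v ⬝ᵥ M *ᵥ v = ((star v ⬝ᵥ M *ᵥ v).re : ℂ) := by
    have := Complex.nonneg_iff.1 (hM.dotProduct_mulVec_nonneg v)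
    exact Complex.ext rfl (by simp [← this.2])
  have key : (star v ⬝ᵥ M *ᵥ v).re ≤ trPair σ M * t := by
    have htr : (vecMulVec v (star v) * M).trace = star v ⬝ᵥ M *ᵥ v := by
      rw [Matrix.trace_mul_comm, Matrix.mul_vecMulVec, Matrix.trace_vecMulVec, dotProduct_comm]
    rcases ht0.eq_or_lt with h0 | h0
    · have hv : v = 0 := by
        rw [← h0] at hvv
        simpa using hvv
      simp [hv, ← h0]
    · have hd : IsDensity (t⁻¹ • vecMulVec v (star v)) := by
        refine ⟨(posSemidef_vecMulVec_self_star v).smul (by positivity), ?_⟩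
        rw [Matrix.trace_smul, Matrix.trace_vecMulVec, dotProduct_comm, hvv, Complex.real_smul]
        rw [← Complex.ofReal_mul, inv_mul_cancel₀ h0.ne', Complex.ofReal_one]
      have h1 : trPair (t⁻¹ • vecMulVec v (star v)) M ≤ trPair σ M := hmax hd
      rw [trPair_smul_left, trPair, htr, inv_mul_le_iff₀ h0] at h1
      linarith
  rw [Matrix.sub_mulVec, dotProduct_sub, Matrix.smul_mulVec, Matrix.one_mulVec, dotProduct_smul,
    hvv, hre, Complex.real_smul, ← Complex.ofReal_mul, ← Complex.ofReal_sub]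
  exact_mod_cast sub_nonneg.2 key

/-- The uniform family divided by a bound `s` on its sum is a sub-POVM; the deficit is added to one
outcome, which is harmless because φ is operator monotone. The scaling law of φ turns the affine
bound at `s` into the normalized value. -/
theorem exists_povm_of_forall_density [Nonempty B] [Nonempty X] {β : ℝ}
    (hβ : β ∈ Set.Icc (0 : ℝ) 1) {τ : X → Matrix B B ℂ} (hτ : ∀ x, (τ x).PosSemidef)
    (htr : β = 0 → ∑ x, classicalMarginal τ x = 1) (r : ℝ)
    (h : ∀ σ : Matrix B B ℂ, IsDensity σ → ∃ Ω : X → Matrix B B ℂ, (∀ x, MatDom β (Ω x)) ∧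
      bnd β r (∑ x, trPair σ (Ω x)) < ∑ x, trPair (τ x) (cfc (phi β) (Ω x))) :
    ∃ E : X → Matrix B B ℂ, IsPOVM E ∧ (∀ x, MatDom β (E x)) ∧
      (if β = 0 then r else Real.exp (β * r)) ≤ ∑ x, trPair (τ x) (cfc (phi β) (E x)) := by
  obtain ⟨Ω, hΩ, hlt⟩ := exists_uniform_family hβ hτ r h
  set M := ∑ x, Ω x with hM
  have hMp : M.PosSemidef := posSemidef_sum _ fun x _ => (hΩ x).posSemidef
  obtain ⟨σ, hσ, hle⟩ := exists_density_le_smul_one hMp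
  set v := ∑ x, trPair (τ x) (cfc (phi β) (Ω x)) with hv
  have ha := bndSlope_pos hβ.1 r
  have h1 : bndSlope β r * trPair σ M + bndConst β r < v := by
    rw [hM, trPair_sum]; exact hlt σ hσ
  obtain ⟨s, hs0, hMs, hsv⟩ : ∃ s : ℝ, 0 < s ∧ M ≤ s • (1 : Matrix B B ℂ) ∧
      bndSlope β r * s + bndConst β r < v := by
    -- Spending half of the strict slack makes `s` positive even when `M` vanishes.
    set δ := (v - (bndSlope β r * trPair σ M + bndConst β r)) / (2 * bndSlope β r) with hδ
    have hδ0 : 0 < δ := div_pos (by linarith) (by linarith)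
    have h0 := trPair_nonneg hσ.1 hMp
    refine ⟨trPair σ M + δ, by linarith, hle.trans ?_, ?_⟩
    · rw [Matrix.le_iff, ← sub_smul]
      exact PosSemidef.one.smul (by linarith)
    · have : bndSlope β r * δ = (v - (bndSlope β r * trPair σ M + bndConst β r)) / 2 := by
        rw [hδ]; field_simp
      linarith
  have hR : ((1 : Matrix B B ℂ) - s⁻¹ • M).PosSemidef := by
    have := (Matrix.le_iff.1 hMs).smul (inv_nonneg.2 hs0.le)
    rwa [smul_sub, smul_smul, inv_mul_cancel₀ hs0.ne', one_smul] at this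
  let x₀ := Classical.arbitrary X
  let R : X → Matrix B B ℂ := fun x => if x = x₀ then 1 - s⁻¹ • M else 0
  have hRp : ∀ x, (R x).PosSemidef := fun x => by
    simp only [R]; split_ifs
    exacts [hR, PosSemidef.zero]
  have hsΩ : ∀ x, MatDom β (s⁻¹ • Ω x) := fun x => (hΩ x).smul (inv_pos.2 hs0)
  have hE : ∀ x, MatDom β (s⁻¹ • Ω x + R x) := fun x => (hsΩ x).add_posSemidef (hRp x)
  refine ⟨fun x => s⁻¹ • Ω x + R x, ⟨fun x => (hE x).posSemidef, ?_⟩, hE, ?_⟩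
  · rw [Finset.sum_add_distrib, ← Finset.smul_sum, ← hM]
    simp [R]
  · have h2 : ∑ x, trPair (τ x) (cfc (phi β) (s⁻¹ • Ω x)) ≤
        ∑ x, trPair (τ x) (cfc (phi β) (s⁻¹ • Ω x + R x)) :=
      Finset.sum_le_sum fun x _ => trPair_mono (hτ x) (cfc_phi_mono hβ (hsΩ x) (by
        rw [Matrix.le_iff, add_sub_cancel_left]; exact hRp x))
    refine le_trans ?_ h2
    by_cases h0 : β = 0
    · subst h0
      have h3 : ∀ x, trPair (τ x) (cfc (phi 0) (s⁻¹ • Ω x)) =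
          Real.log s⁻¹ * classicalMarginal τ x + trPair (τ x) (cfc (phi 0) (Ω x)) := by
        intro x
        have hd : (Ω x).PosDef := by simpa [MatDom] using hΩ x
        rw [cfc_phi_smul_zero hd (inv_pos.2 hs0), trPair_add, trPair_smul, trPair_one]
        rfl
      rw [Finset.sum_congr rfl fun x _ => h3 x, Finset.sum_add_distrib, ← Finset.mul_sum,
        htr rfl, ← hv, if_pos rfl, Real.log_inv]
      have := Real.log_le_sub_one_of_pos hs0
      simp only [bndSlope, bndConst, if_true] at hsv
      linarith
    · have h3 : ∀ x, trPair (τ x) (cfc (phi β) (s⁻¹ • Ω x)) =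
          s⁻¹ ^ β * trPair (τ x) (cfc (phi β) (Ω x)) := fun x => by
        rw [cfc_phi_smul_of_ne h0 (hΩ x).posSemidef (inv_nonneg.2 hs0.le), trPair_smul]
      rw [Finset.sum_congr rfl fun x _ => h3 x, ← Finset.mul_sum, ← hv, if_neg h0,
        Real.inv_rpow hs0.le, inv_mul_eq_div, le_div_iff₀ (Real.rpow_pos_of_pos hs0 _)]
      have := (bnd_le_affine hβ r hs0.le).trans hsv.le
      rwa [bnd, if_neg h0] at this

end Povm

/-! ### Variational formula for the Rényi entropy -/

section Entropy

variable {ι : Type*} [Fintype ι]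

/-- Negative entropy is divergence from counting measure, which brings entropy under the same
variational formula. -/
theorem renyiDiv_one_right_le_iff {α : ℝ≥0∞} (h1 : 1 ≤ α) {p : ι → ℝ} (hp : ∀ i, 0 ≤ p i)
    (hp1 : ∑ i, p i = 1) (r : ℝ) : renyiDiv α p (fun _ => 1) ≤ r ↔ -renyiEntropy α p ≤ r := by
  have hne : Nonempty ι := by
    by_contra hne
    rw [not_nonempty_iff] at hne
    simp at hp1
  obtain ⟨i₀, hi₀⟩ : ∃ i, 0 < p i := by
    by_contra! hcon
    have := Finset.sum_nonpos fun i (_ : i ∈ Finset.univ) => hcon i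
    linarith
  unfold renyiEntropy
  rcases h1.eq_or_lt with rfl | h1
  · simp [renyiDiv]
  rw [if_neg h1.ne']
  rcases eq_or_ne α ⊤ with rfl | ht
  · have hbdd : BddAbove (Set.range p) := Set.finite_range p |>.bddAbove
    have hsup : 0 < ⨆ i, p i := hi₀.trans_le (le_ciSup hbdd i₀)
    rw [if_pos rfl, neg_neg, Real.log_le_iff_le_exp hsup, ciSup_le_iff hbdd,
      renyiDiv_top_le_iff hp (fun _ => zero_le_one)]
    constructor
    · intro h i
      classical
      simpa [Pi.single_apply] using h (Pi.single i 1) (fun j => by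
        by_cases hj : j = i <;> simp [hj])
    · intro h g hg
      simp only [one_mul, Finset.mul_sum]
      exact Finset.sum_le_sum fun i _ => mul_le_mul_of_nonneg_right (h i) (hg i)
  · have ha : 1 < α.toReal := by
      simpa using (ENNReal.toReal_lt_toReal ENNReal.one_ne_top ht).2 h1
    have hT : 0 < ∑ i, p i ^ α.toReal :=
      Finset.sum_pos' (fun i _ => Real.rpow_nonneg (hp i) _)
        ⟨i₀, Finset.mem_univ _, Real.rpow_pos_of_pos hi₀ _⟩
    rw [if_neg ht, renyiDiv_finite_le_iff_sum h1 ht]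
    have : ∑ i, ENNReal.ofReal (p i) ^ α.toReal * ENNReal.ofReal 1 ^ (1 - α.toReal) =
        ENNReal.ofReal (∑ i, p i ^ α.toReal) := by
      rw [ENNReal.ofReal_sum_of_nonneg fun i _ => Real.rpow_nonneg (hp i) _]
      refine Finset.sum_congr rfl fun i _ => ?_
      rw [ENNReal.ofReal_one, ENNReal.one_rpow, mul_one,
        ENNReal.ofReal_rpow_of_nonneg (hp i) (by linarith)]
    rw [this, ENNReal.ofReal_le_ofReal_iff (Real.exp_pos _).le, ← Real.log_le_iff_le_exp hT]
    have h2 : -(1 / (1 - α.toReal) * Real.log (∑ i, p i ^ α.toReal)) =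
        (α.toReal - 1)⁻¹ * Real.log (∑ i, p i ^ α.toReal) := by
      rw [← neg_sub α.toReal 1, one_div, inv_neg]; ring
    rw [h2, inv_mul_le_iff₀ (by linarith)]

/-- Variational characterization of the Rényi entropy. -/
theorem neg_renyiEntropy_le_iff {α : ℝ≥0∞} (h1 : 1 ≤ α) {p : ι → ℝ} (hp : ∀ i, 0 ≤ p i)
    (hp1 : ∑ i, p i = 1) (r : ℝ) : -renyiEntropy α p ≤ r ↔
      ∀ g : ι → ℝ, (∀ i, PhiDom (gainExponent α) (g i)) →
        ∑ i, p i * phi (gainExponent α) (g i) ≤ bnd (gainExponent α) r (∑ i, g i) := by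
  rw [← renyiDiv_one_right_le_iff h1 hp hp1,
    renyiDiv_le_iff h1 hp (fun _ => zero_le_one) (fun _ => hp1)]
  simp only [one_mul]

end Entropy

/-! ### Comparison of extended reals with real thresholds -/

section EReal

theorem coe_mul_log_le_iff {c : ℝ} (hc : 0 < c) (t : ℝ≥0∞) (z : ℝ) :
    (c : EReal) * ENNReal.log t ≤ z ↔ t ≤ ENNReal.ofReal (Real.exp (c⁻¹ * z)) := by
  have hr : ((c⁻¹ * z : ℝ) : EReal) = ENNReal.log (ENNReal.ofReal (Real.exp (c⁻¹ * z))) := by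
    rw [ENNReal.log_ofReal_of_pos (Real.exp_pos _), Real.log_exp]
  rw [← ENNReal.log_le_log_iff, ← hr]
  induction ENNReal.log t with
  | bot => rw [EReal.coe_mul_bot_of_pos hc]; simp only [bot_le]
  | top =>
    rw [EReal.coe_mul_top_of_pos hc]
    exact iff_of_false (EReal.coe_lt_top _).not_ge (EReal.coe_lt_top _).not_ge
  | coe x =>
    rw [← EReal.coe_mul, EReal.coe_le_coe_iff, EReal.coe_le_coe_iff, le_inv_mul_iff₀ hc]

theorem le_coe_mul_log_iff {c : ℝ} (hc : 0 < c) (t : ℝ≥0∞) (z : ℝ) :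
    (z : EReal) ≤ c * ENNReal.log t ↔ ENNReal.ofReal (Real.exp (c⁻¹ * z)) ≤ t := by
  have hr : ((c⁻¹ * z : ℝ) : EReal) = ENNReal.log (ENNReal.ofReal (Real.exp (c⁻¹ * z))) := by
    rw [ENNReal.log_ofReal_of_pos (Real.exp_pos _), Real.log_exp]
  rw [← ENNReal.log_le_log_iff, ← hr]
  induction ENNReal.log t with
  | bot =>
    rw [EReal.coe_mul_bot_of_pos hc]
    exact iff_of_false (EReal.bot_lt_coe _).not_ge (EReal.bot_lt_coe _).not_ge
  | top => rw [EReal.coe_mul_top_of_pos hc]; simp only [le_top]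
  | coe x =>
    rw [← EReal.coe_mul, EReal.coe_le_coe_iff, EReal.coe_le_coe_iff, inv_mul_le_iff₀ hc]

theorem ereal_le_of_forall_real_lt {x y : EReal} (h : ∀ z : ℝ, y < z → x ≤ z) : x ≤ y := by
  by_contra! hlt
  obtain ⟨z, h1, h2⟩ := EReal.lt_iff_exists_real_btwn.1 hlt
  exact absurd (h z h1) h2.not_ge

end EReal

/-! ### Arimoto information and real thresholds -/

section Arimoto

variable {X B : Type*} [Fintype X] [DecidableEq X] [Fintype B] [DecidableEq B]

theorem arimotoInfo_eq (α : ℝ≥0∞) (τ : X → Matrix B B ℂ) :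
    arimotoInfo α τ = (renyiEntropy α (classicalMarginal τ) : EReal) +
      ⨅ (σ : Matrix B B ℂ) (_ : IsDensity σ), measuredDiv α (cqOp τ) (cqOp fun _ => σ) := by
  rw [arimotoInfo, measuredCondEntropy, sub_eq_add_neg, neg_neg]
  simp only [one_kronecker_eq_cqOp]

theorem arimotoInfo_le {α : ℝ≥0∞} {τ : X → Matrix B B ℂ} {σ : Matrix B B ℂ} (hσ : IsDensity σ)
    {z : ℝ} (h : measuredDiv α (cqOp τ) (cqOp fun _ => σ) ≤
      ((z - renyiEntropy α (classicalMarginal τ) : ℝ) : EReal)) : arimotoInfo α τ ≤ z := by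
  rw [arimotoInfo_eq]
  have : (z : EReal) = (renyiEntropy α (classicalMarginal τ) : EReal) +
      ((z - renyiEntropy α (classicalMarginal τ) : ℝ) : EReal) := by
    rw [← EReal.coe_add]; congr 1; ring
  rw [this]
  exact add_le_add le_rfl ((iInf₂_le σ hσ).trans h)

theorem exists_of_arimotoInfo_lt {α : ℝ≥0∞} {τ : X → Matrix B B ℂ} {z : ℝ}
    (h : arimotoInfo α τ < z) : ∃ σ : Matrix B B ℂ, IsDensity σ ∧
      measuredDiv α (cqOp τ) (cqOp fun _ => σ) ≤
        ((z - renyiEntropy α (classicalMarginal τ) : ℝ) : EReal) := by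
  by_contra! hcon
  refine absurd h (not_lt.2 ?_)
  rw [arimotoInfo_eq]
  have : (z : EReal) = (renyiEntropy α (classicalMarginal τ) : EReal) +
      ((z - renyiEntropy α (classicalMarginal τ) : ℝ) : EReal) := by
    rw [← EReal.coe_add]; congr 1; ring
  rw [this]
  exact add_le_add le_rfl (le_iInf₂ fun σ hσ => (hcon σ hσ).le)

end Arimoto

/-! ### Leakage equals measured Arimoto information -/

section Leakage

variable {X B : Type*} [Fintype X] [DecidableEq X] [Fintype B] [DecidableEq B]

theorem classicalMarginal_nonneg {τ : X → Matrix B B ℂ} (hτ : ∀ x, (τ x).PosSemidef) (x : X) :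
    0 ≤ classicalMarginal τ x :=
  (Complex.nonneg_iff.1 (hτ x).trace_nonneg).1

theorem nonempty_of_sum_marginal {τ : X → Matrix B B ℂ} (h : ∑ x, classicalMarginal τ x = 1) :
    Nonempty X ∧ Nonempty B := by
  constructor
  · by_contra hne
    rw [not_nonempty_iff] at hne
    simp at h
  · by_contra hne
    rw [not_nonempty_iff] at hne
    simp [classicalMarginal] at h

theorem gain_eq {α : ℝ≥0∞} (h1 : 1 < α) (τ : X → Matrix B B ℂ) {E : X → Matrix B B ℂ}
    (hE : IsPOVM E) :
    (cqOp τ * cfc (fun t : ℝ => t ^ gainExponent α) (cqOp E)).trace.re =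
      ∑ x, trPair (τ x) (cfc (phi (gainExponent α)) (E x)) := by
  have h0 := (gainExponent_pos h1).ne'
  rw [trPair_def, cfc_cqOp fun x => (hE.1 x).isHermitian, trPair_cqOp, phi_of_ne h0]
  simp only [block_cqOp]

/-- Both sides of the entropy formula are homogeneous of degree `β` in the test function, so
normalized test functions determine it. -/
theorem priorGain_eq {α : ℝ≥0∞} (h1 : 1 < α) {p : X → ℝ} (hp : p ∈ stdSimplex ℝ X) :
    priorGain α p = ENNReal.ofReal (Real.exp (gainExponent α * -renyiEntropy α p)) := by
  have hβ := gainExponent_pos h1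
  have h0 := hβ.ne'
  have key := neg_renyiEntropy_le_iff h1.le hp.1 hp.2
  simp only [PhiDom, phi, bnd, h0, if_false] at key
  refine le_antisymm (iSup₂_le fun q hq => ENNReal.ofReal_le_ofReal ?_) ?_
  · have := (key _).1 le_rfl q hq.1
    rwa [hq.2, Real.one_rpow, mul_one] at this
  · by_contra! hlt
    obtain ⟨t, ht0, htt⟩ : ∃ t : ℝ, 0 ≤ t ∧ priorGain α p = ENNReal.ofReal t :=
      ⟨(priorGain α p).toReal, ENNReal.toReal_nonneg,
        (ENNReal.ofReal_toReal (hlt.trans ENNReal.ofReal_lt_top).ne).symm⟩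
    have hub : ∀ q ∈ stdSimplex ℝ X, ∑ x, p x * q x ^ gainExponent α ≤ t := by
      intro q hq
      have : ENNReal.ofReal (∑ x, p x * q x ^ gainExponent α) ≤ priorGain α p :=
        le_iSup₂_of_le q hq le_rfl
      rwa [htt, ENNReal.ofReal_le_ofReal_iff ht0] at this
    have htpos : 0 < t := by
      refine lt_of_lt_of_le ?_ (hub p hp)
      obtain ⟨i, hi⟩ : ∃ i, 0 < p i := by
        by_contra! hcon
        have := Finset.sum_nonpos fun i (_ : i ∈ Finset.univ) => hcon i
        rw [hp.2] at this
        linarith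
      exact Finset.sum_pos' (fun i _ => mul_nonneg (hp.1 i) (Real.rpow_nonneg (hp.1 i) _))
        ⟨i, Finset.mem_univ _, mul_pos hi (Real.rpow_pos_of_pos hi _)⟩
    have hle := (key ((gainExponent α)⁻¹ * Real.log t)).2 (by
      intro g hg
      rw [← mul_assoc, mul_inv_cancel₀ h0, one_mul, Real.exp_log htpos]
      rcases (Finset.sum_nonneg fun i (_ : i ∈ Finset.univ) => hg i).eq_or_lt with hs | hs
      · have hz := (Finset.sum_eq_zero_iff_of_nonneg fun i _ => hg i).1 hs.symm
        rw [← hs, Real.zero_rpow h0, mul_zero]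
        refine (Finset.sum_eq_zero fun i hi => ?_).le
        rw [hz i hi, Real.zero_rpow h0, mul_zero]
      · have := hub (fun i => g i / ∑ j, g j)
          ⟨fun i => div_nonneg (hg i) hs.le, by rw [← Finset.sum_div, div_self hs.ne']⟩
        simp only [Real.div_rpow (hg _) hs.le, ← mul_div_assoc, ← Finset.sum_div] at this
        rwa [div_le_iff₀ (Real.rpow_pos_of_pos hs _)] at this)
    rw [htt] at hlt
    refine absurd hlt (not_lt.2 (ENNReal.ofReal_le_ofReal ?_))
    rw [← Real.le_log_iff_exp_le htpos, ← le_inv_mul_iff₀ hβ]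
    exact hle

theorem ofReal_exp_div (a b : ℝ) : ENNReal.ofReal (Real.exp a) / ENNReal.ofReal (Real.exp b) =
    ENNReal.ofReal (Real.exp (a - b)) := by
  rw [Real.exp_sub, ENNReal.ofReal_div_of_pos (Real.exp_pos b)]

/-- The prior gain supplies the entropy term. For the other term, a POVM used as a test family
bounds the gain, and `exists_povm_of_forall_density` supplies POVMs reaching any threshold below the
infimum over `σ`. -/
theorem leakage_eq_arimotoInfo_of_one_lt {α : ℝ≥0∞} (h1 : 1 < α) {τ : X → Matrix B B ℂ}
    (hτ : ∀ x, (τ x).PosSemidef) (htr : ∑ x, classicalMarginal τ x = 1) :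
    leakage α τ = arimotoInfo α τ := by
  obtain ⟨hX, hB⟩ := nonempty_of_sum_marginal htr
  set H := renyiEntropy α (classicalMarginal τ) with hH
  have hβ := gainExponent_pos h1
  have h0 := hβ.ne'
  have hβI := gainExponent_mem h1.le
  have hprior := priorGain_eq h1 (p := classicalMarginal τ) ⟨classicalMarginal_nonneg hτ, htr⟩
  rw [leakage, if_neg h1.ne', hprior, ← hH]
  refine le_antisymm ?_ ?_
  · refine ereal_le_of_forall_real_lt fun z hz => ?_
    obtain ⟨σ, hσ, hD⟩ := exists_of_arimotoInfo_lt hz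
    rw [measuredDiv_cqOp_le_iff h1.le hτ (fun _ => hσ.1) (fun h => absurd h h1.ne'), ← hH] at hD
    rw [coe_mul_log_le_iff (inv_pos.2 hβ), inv_inv]
    have hg : maxGain α τ ≤ ENNReal.ofReal (Real.exp (gainExponent α * (z - H))) := by
      refine iSup₂_le fun E hE => ENNReal.ofReal_le_ofReal ?_
      rw [gain_eq h1 τ hE]
      refine (hD E fun x => by simpa [MatDom, h0] using hE.1 x).trans ?_
      rw [hE.sum_trPair, hσ.trace_re, bnd, if_neg h0, Real.one_rpow, mul_one]
    refine (ENNReal.div_le_div_right hg _).trans ?_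
    rw [ofReal_exp_div]
    refine ENNReal.ofReal_le_ofReal (Real.exp_le_exp.2 (le_of_eq ?_))
    ring
  · refine ereal_le_of_forall_real_lt fun z hz => ?_
    by_contra! hlt
    refine absurd hz (not_lt.2 ?_)
    obtain ⟨E, hE, _, hle⟩ := exists_povm_of_forall_density hβI hτ (fun h => absurd h h0) (z - H)
      (by
        intro σ hσ
        by_contra! hcon
        refine absurd (arimotoInfo_le hσ ?_) hlt.not_ge
        rw [measuredDiv_cqOp_le_iff h1.le hτ (fun _ => hσ.1) (fun h => absurd h h1.ne')]
        exact hcon)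
    rw [if_neg h0] at hle
    rw [le_coe_mul_log_iff (inv_pos.2 hβ), inv_inv]
    have hg : ENNReal.ofReal (Real.exp (gainExponent α * (z - H))) ≤ maxGain α τ := by
      refine le_iSup₂_of_le E hE (ENNReal.ofReal_le_ofReal ?_)
      rwa [gain_eq h1 τ hE]
    refine le_trans ?_ (ENNReal.div_le_div_right hg _)
    rw [ofReal_exp_div]
    refine ENNReal.ofReal_le_ofReal (Real.exp_le_exp.2 (le_of_eq ?_))
    ring

theorem priorLogLoss_eq {p : X → ℝ} (hp : p ∈ stdSimplex ℝ X) :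
    priorLogLoss p = (renyiEntropy 1 p : EReal) := by
  unfold priorLogLoss
  refine le_antisymm ?_ (le_iInf₂ fun q hq => ?_)
  · refine iInf₂_le_of_le p hp ?_
    rw [if_pos fun _ h => h, renyiEntropy, if_pos rfl]
  · split_ifs with h
    · rw [EReal.coe_le_coe_iff, renyiEntropy, if_pos rfl, neg_le_neg_iff]
      have key : ∀ x, p x * Real.log (q x) - p x * Real.log (p x) ≤ q x - p x := by
        intro x
        rcases (hp.1 x).eq_or_lt with h0 | h0
        · rw [← h0]; simpa using hq.1 x
        · have hqx : 0 < q x := (hq.1 x).lt_of_ne fun hz => h0.ne' (h x hz.symm)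
          have h2 := Real.log_le_sub_one_of_pos (div_pos hqx h0)
          rw [Real.log_div hqx.ne' h0.ne'] at h2
          have h3 := mul_le_mul_of_nonneg_left h2 h0.le
          rw [mul_sub, mul_sub, mul_one, mul_div_cancel₀ _ h0.ne'] at h3
          exact h3
      have := Finset.sum_le_sum fun x (_ : x ∈ Finset.univ) => key x
      rw [Finset.sum_sub_distrib, Finset.sum_sub_distrib, hp.2, hq.2] at this
      linarith
    · exact le_top

/-- Extends the order-one bound from positive definite tests to singular ones. Adding `ε` times the
kernel projection `P` makes `E` definite, and the divergent term `log ε` is multiplied by `Tr ρ P =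
0`. -/
theorem trPair_cfc_log_le {n : Type*} [Fintype n] [DecidableEq n] {ρ κ E : Matrix n n ℂ} {r : ℝ}
    (h : ∀ Ω : Matrix n n ℂ, Ω.PosDef → trPair ρ (cfc Real.log Ω) ≤ r + trPair κ Ω - 1)
    (hE : E.PosSemidef) (hker : ∀ v, E *ᵥ v = 0 → ρ *ᵥ v = 0) :
    trPair ρ (cfc Real.log E) ≤ r + trPair κ E - 1 := by
  set P := cfc (fun t : ℝ => if t = 0 then (1 : ℝ) else 0) E with hP
  have hh : IsSelfAdjoint E := hE.isHermitian
  have hEP : E * P = 0 := by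
    have h1 : cfc (fun t : ℝ => t) E = E := cfc_id' ℝ E hh
    have h2 : cfc (fun t : ℝ => t * (if t = 0 then (1 : ℝ) else 0)) E =
        cfc (fun t : ℝ => t) E * P :=
      cfc_mul _ _ E (continuousOn_spectrum _ _) (continuousOn_spectrum _ _)
    rw [h1] at h2
    rw [← h2]
    have h3 : (fun t : ℝ => t * (if t = 0 then (1 : ℝ) else 0)) = fun _ => 0 := by
      funext t; by_cases ht : t = 0 <;> simp [ht]
    rw [h3]
    exact cfc_const_zero ℝ E
  have hρP : ρ * P = 0 := by
    ext i j
    have h1 : E *ᵥ (fun k => P k j) = 0 := by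
      ext k
      exact congrFun (congrFun hEP k) j
    exact congrFun (hker _ h1) i
  have hmain : ∀ ε : ℝ, 0 < ε →
      trPair ρ (cfc Real.log E) ≤ r + trPair κ E - 1 + ε * trPair κ P := by
    intro ε hε
    have e1 : E + ε • P = cfc (fun t : ℝ => t + ε * if t = 0 then (1 : ℝ) else 0) E := by
      have h1 : cfc (fun t : ℝ => t) E = E := cfc_id' ℝ E hh
      have h2 : cfc (fun t : ℝ => t + ε * if t = 0 then (1 : ℝ) else 0) E =
          cfc (fun t : ℝ => t) E + cfc (fun t : ℝ => ε * if t = 0 then (1 : ℝ) else 0) E :=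
        cfc_add E _ _ (continuousOn_spectrum _ _) (continuousOn_spectrum _ _)
      have h3 : cfc (fun t : ℝ => ε * if t = 0 then (1 : ℝ) else 0) E = ε • P :=
        cfc_const_mul ε _ E (continuousOn_spectrum _ _)
      rw [h2, h3, h1]
    obtain ⟨F, hF, hF'⟩ := exists_spectral_povm hE.isHermitian
    have hPD : (E + ε • P).PosDef := by
      have : MatDom 0 (E + ε • P) := by
        rw [e1, hF']
        refine matDom_povm_sum hF fun i => ?_
        simp only [PhiDom, if_true]
        have := hE.eigenvalues_nonneg i
        split_ifs with hz
        · linarith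
        · have := this.lt_of_ne (Ne.symm hz)
          linarith
      simpa [MatDom] using this
    have e2 : cfc Real.log (E + ε • P) = cfc Real.log E + Real.log ε • P := by
      have h1 : cfc (fun t : ℝ => Real.log (t + ε * if t = 0 then (1 : ℝ) else 0)) E =
          cfc Real.log (cfc (fun t : ℝ => t + ε * if t = 0 then (1 : ℝ) else 0) E) :=
        cfc_comp' Real.log _ E ((Matrix.finite_real_spectrum.image _).continuousOn _)
          (continuousOn_spectrum _ _) hh
      -- Here `Real.log 0 = 0` matters: `cfc Real.log E` already vanishes on the kernel.
      have h2 : (fun t : ℝ => Real.log (t + ε * if t = 0 then (1 : ℝ) else 0)) =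
          fun t : ℝ => Real.log t + Real.log ε * if t = 0 then (1 : ℝ) else 0 := by
        funext t; by_cases ht : t = 0 <;> simp [ht]
      have h3 : cfc (fun t : ℝ => Real.log t + Real.log ε * if t = 0 then (1 : ℝ) else 0) E =
          cfc Real.log E + cfc (fun t : ℝ => Real.log ε * if t = 0 then (1 : ℝ) else 0) E :=
        cfc_add E _ _ (continuousOn_spectrum _ _) (continuousOn_spectrum _ _)
      have h4 : cfc (fun t : ℝ => Real.log ε * if t = 0 then (1 : ℝ) else 0) E =
          Real.log ε • P := cfc_const_mul _ _ E (continuousOn_spectrum _ _)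
      rw [e1, ← h1, h2, h3, h4]
    have := h _ hPD
    rw [e2, trPair_add, trPair_add, trPair_smul, trPair_smul] at this
    have hz : trPair ρ P = 0 := by rw [trPair, hρP]; simp
    rw [hz] at this
    linarith
  refine le_of_forall_pos_le_add fun δ hδ => ?_
  have h1 := hmain (δ / (1 + |trPair κ P|)) (by positivity)
  have h2 : δ / (1 + |trPair κ P|) * trPair κ P ≤ δ := by
    rw [div_mul_eq_mul_div, div_le_iff₀ (by positivity)]
    have := le_abs_self (trPair κ P)
    nlinarith
  linarith

theorem leakage_one_eq_arimotoInfo {τ : X → Matrix B B ℂ}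
    (hτ : ∀ x, (τ x).PosSemidef) (htr : ∑ x, classicalMarginal τ x = 1) :
    leakage 1 τ = arimotoInfo 1 τ := by
  obtain ⟨hX, hB⟩ := nonempty_of_sum_marginal htr
  set H := renyiEntropy 1 (classicalMarginal τ) with hH
  rw [leakage, if_pos rfl, priorLogLoss_eq ⟨classicalMarginal_nonneg hτ, htr⟩, ← hH]
  refine le_antisymm ?_ ?_
  · refine ereal_le_of_forall_real_lt fun z hz => ?_
    obtain ⟨σ, hσ, hD⟩ := exists_of_arimotoInfo_lt hz
    rw [measuredDiv_le_iff le_rfl (cqOp_posSemidef hτ) (cqOp_posSemidef fun _ => hσ.1)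
      (fun _ => by rw [trace_cqOp, htr]), ← hH] at hD
    simp only [gainExponent_one, MatDom, phi_zero, bnd, if_true] at hD
    have hm : (((H - z : ℝ)) : EReal) ≤ minLogLoss τ := by
      refine le_iInf₂ fun E hE => ?_
      unfold expectedLogLoss
      split_ifs with hker
      · rw [EReal.coe_le_coe_iff, trPair_def]
        have := trPair_cfc_log_le hD (cqOp_posSemidef hE.1) hker
        rw [trPair_cqOp (fun _ => σ)] at this
        simp only [block_cqOp] at this
        rw [hE.sum_trPair, hσ.trace_re] at this
        linarith
      · exact le_top
    refine (EReal.sub_le_sub le_rfl hm).trans (le_of_eq ?_)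
    rw [← EReal.coe_sub]
    congr 1; ring
  · refine ereal_le_of_forall_real_lt fun z hz => ?_
    by_contra! hlt
    refine absurd hz (not_lt.2 ?_)
    obtain ⟨E, hE, hEd, hle⟩ := exists_povm_of_forall_density (β := 0) (by simp) hτ
      (fun _ => htr) (z - H) (by
        intro σ hσ
        by_contra! hcon
        refine absurd (arimotoInfo_le hσ ?_) hlt.not_ge
        rw [measuredDiv_cqOp_le_iff le_rfl hτ (fun _ => hσ.1) (fun _ => htr), gainExponent_one]
        exact hcon)
    rw [if_pos rfl] at hle
    have hm : minLogLoss τ ≤ ((H - z : ℝ) : EReal) := by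
      refine iInf₂_le_of_le E hE ?_
      have hPD : (cqOp E).PosDef := by simpa [MatDom] using cqOp_matDom hEd
      unfold expectedLogLoss
      rw [if_pos]
      · rw [EReal.coe_le_coe_iff, trPair_def, cfc_cqOp fun x => (hE.1 x).isHermitian,
          trPair_cqOp]
        simp only [block_cqOp]
        rw [phi_zero] at hle
        linarith
      · intro v hv
        have : v = 0 := by
          have hinj := Matrix.mulVec_injective_iff_isUnit.2 hPD.isUnit
          exact hinj (by simpa using hv)
        simp [this]
    refine le_trans (le_of_eq ?_) (EReal.sub_le_sub le_rfl hm)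
    rw [← EReal.coe_sub]
    congr 1; ring

theorem leakage_eq_arimotoInfo {α : ℝ≥0∞} (h1 : 1 ≤ α) {τ : X → Matrix B B ℂ}
    (hτ : ∀ x, (τ x).PosSemidef) (htr : ∑ x, classicalMarginal τ x = 1) :
    leakage α τ = arimotoInfo α τ := by
  rcases h1.eq_or_lt with rfl | h1
  · exact leakage_one_eq_arimotoInfo hτ htr
  · exact leakage_eq_arimotoInfo_of_one_lt h1 hτ htr

end Leakage

/-! ### Data processing and the order-one case -/

section DataProcessing

variable {X S B : Type*} [Fintype X] [DecidableEq X] [Fintype S] [DecidableEq S] [Fintype B]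
  [DecidableEq B]

/-- The c-q operator obtained by applying the classical channel `W` to the classical system. -/
noncomputable def postProcess (W : X → S → ℝ) (τ : X → Matrix B B ℂ) : S → Matrix B B ℂ :=
  fun s => ∑ x, W x s • τ x

theorem postProcess_posSemidef {W : X → S → ℝ} (hW : ∀ x, W x ∈ stdSimplex ℝ S)
    {τ : X → Matrix B B ℂ} (hτ : ∀ x, (τ x).PosSemidef) (s : S) :
    (postProcess W τ s).PosSemidef :=
  posSemidef_sum _ fun x _ => (hτ x).smul ((hW x).1 s)

theorem classicalMarginal_postProcess (W : X → S → ℝ) (τ : X → Matrix B B ℂ) (s : S) :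
    classicalMarginal (postProcess W τ) s = ∑ x, W x s * classicalMarginal τ x := by
  simp [classicalMarginal, postProcess, Matrix.trace_sum]

theorem sum_classicalMarginal_postProcess {W : X → S → ℝ} (hW : ∀ x, W x ∈ stdSimplex ℝ S)
    (τ : X → Matrix B B ℂ) :
    ∑ s, classicalMarginal (postProcess W τ) s = ∑ x, classicalMarginal τ x := by
  simp only [classicalMarginal_postProcess]
  rw [Finset.sum_comm]
  refine Finset.sum_congr rfl fun x _ => ?_
  rw [← Finset.sum_mul, (hW x).2, one_mul]

theorem eq_zero_of_classicalMarginal {τ : X → Matrix B B ℂ} {x : X} (hτ : (τ x).PosSemidef)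
    (h : classicalMarginal τ x = 0) : τ x = 0 := by
  rw [← hτ.trace_eq_zero_iff]
  have := Complex.nonneg_iff.1 hτ.trace_nonneg
  exact Complex.ext h this.2.symm

/-- Data processing on the classical system for the measured Arimoto information of order one. -/
theorem arimotoInfo_one_postProcess_le {W : X → S → ℝ} (hW : ∀ x, W x ∈ stdSimplex ℝ S)
    {τ : X → Matrix B B ℂ} (hτ : ∀ x, (τ x).PosSemidef)
    (htr : ∑ x, classicalMarginal τ x = 1) :
    arimotoInfo 1 (postProcess W τ) ≤ arimotoInfo 1 τ := by
  refine ereal_le_of_forall_real_lt fun z hz => ?_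
  obtain ⟨σ, hσ, hD⟩ := exists_of_arimotoInfo_lt hz
  have hτ' := postProcess_posSemidef hW hτ
  have htr' : ∑ s, classicalMarginal (postProcess W τ) s = 1 := by
    rw [sum_classicalMarginal_postProcess hW, htr]
  refine arimotoInfo_le hσ ?_
  rw [measuredDiv_cqOp_le_iff le_rfl hτ (fun _ => hσ.1) (fun _ => htr)] at hD
  rw [measuredDiv_cqOp_le_iff le_rfl hτ' (fun _ => hσ.1) (fun _ => htr')]
  simp only [gainExponent_one, MatDom, phi_zero, bnd, if_true, renyiEntropy] at hD ⊢
  intro Ω hΩ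
  set p := classicalMarginal τ with hp
  set p' := classicalMarginal (postProcess W τ) with hp'
  have hp0 : ∀ x, 0 ≤ p x := classicalMarginal_nonneg hτ
  have hp0' : ∀ s, 0 ≤ p' s := classicalMarginal_nonneg hτ'
  have hpp' : ∀ s, p' s = ∑ x, W x s * p x := classicalMarginal_postProcess W τ
  have hWz : ∀ x s, p x ≠ 0 → p' s = 0 → W x s = 0 := by
    intro x s hx hs
    rw [hpp' s, Finset.sum_eq_zero_iff_of_nonneg
      (fun x _ => mul_nonneg ((hW x).1 s) (hp0 x))] at hs
    exact (mul_eq_zero.1 (hs x (Finset.mem_univ x))).resolve_right hx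
  -- For `p' s ≠ 0`, `W x s * c x s` is the posterior probability of `x` given `s`. Averaging `Ω s`
  -- with these weights builds the test operator for `X`. The value `1` at `p' s = 0` only keeps `c`
  -- positive: `W x s` vanishes there whenever `p x ≠ 0`.
  let c : X → S → ℝ := fun x s => if p' s = 0 then 1 else p x / p' s
  have hc : ∀ x s, p x ≠ 0 → 0 < c x s := fun x s hx => by
    simp only [c]; split_ifs with hs
    · exact one_pos
    · exact div_pos ((hp0 x).lt_of_ne (Ne.symm hx)) ((hp0' s).lt_of_ne (Ne.symm hs))
  have hconc : ∀ x, p x ≠ 0 → trPair (τ x) (∑ s, W x s • cfc Real.log (c x s • Ω s)) ≤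
      trPair (τ x) (cfc Real.log (∑ s, W x s • c x s • Ω s)) := by
    intro x hx
    have := (concaveOn_cfc_phi (n := B) (β := 0) (by simp)).le_map_sum
      (t := Finset.univ) (w := W x) (p := fun s => c x s • Ω s) (fun s _ => (hW x).1 s) (hW x).2
      (fun s _ => by simpa [MatDom] using (hΩ s).smul (hc x s hx))
    rw [phi_zero] at this
    exact trPair_mono (hτ x) this
  -- The scalar `log c = log p - log p'` accounts exactly for the difference between the entropies
  -- of `X` and `S`.
  have hlog : ∀ x s, p x ≠ 0 → W x s * trPair (τ x) (cfc Real.log (c x s • Ω s)) =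
      W x s * trPair (τ x) (cfc Real.log (Ω s)) +
        W x s * p x * Real.log (p x) - W x s * p x * Real.log (p' s) := by
    intro x s hx
    by_cases hs : p' s = 0
    · simp [hWz x s hx hs]
    · have := cfc_phi_smul_zero (hΩ s) (hc x s hx)
      rw [phi_zero] at this
      rw [this, trPair_add, trPair_smul, trPair_one, show (τ x).trace.re = p x from rfl]
      simp only [c, if_neg hs]
      rw [Real.log_div hx hs]
      ring
  have hterm : ∀ x, ∑ s, W x s * trPair (τ x) (cfc Real.log (Ω s)) + p x * Real.log (p x) -
      ∑ s, W x s * p x * Real.log (p' s) ≤ if p x = 0 then 0 else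
        trPair (τ x) (cfc Real.log (∑ s, W x s • c x s • Ω s)) := by
    intro x
    by_cases hx : p x = 0
    · have hz := eq_zero_of_classicalMarginal (hτ x) hx
      simp [hx, hz, trPair]
    · rw [if_neg hx]
      refine le_trans (le_of_eq ?_) (hconc x hx)
      simp only [trPair_sum, trPair_smul]
      rw [Finset.sum_congr rfl fun s _ => hlog x s hx, Finset.sum_sub_distrib,
        Finset.sum_add_distrib, ← Finset.sum_mul, ← Finset.sum_mul, (hW x).2, one_mul]
  -- Symbols of zero probability still need a positive definite test operator; `ε • 1` is used and
  -- its cost `ε * card X` is removed in the limit.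
  have hmain : ∀ ε : ℝ, 0 < ε →
      ∑ x, (if p x = 0 then 0 else
        trPair (τ x) (cfc Real.log (∑ s, W x s • c x s • Ω s))) ≤
      z - -∑ x, p x * Real.log (p x) + (∑ s, trPair σ (Ω s) + ε * Fintype.card X) - 1 := by
    intro ε hε
    have h1 := hD (fun x => if p x = 0 then ε • 1 else ∑ s, W x s • c x s • Ω s) (fun x => by
      split_ifs with hx
      · exact PosDef.one.smul hε
      · have : MatDom 0 (∑ s, W x s • c x s • Ω s) :=
          (convex_matDom 0).sum_mem (fun s _ => (hW x).1 s) (hW x).2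
            fun s _ => MatDom.of_posDef ((hΩ s).smul (hc x s hx))
        simpa [MatDom] using this)
    have h2 : ∑ x, trPair (τ x) (cfc Real.log
        (if p x = 0 then ε • 1 else ∑ s, W x s • c x s • Ω s)) =
        ∑ x, (if p x = 0 then 0 else
          trPair (τ x) (cfc Real.log (∑ s, W x s • c x s • Ω s))) := by
      refine Finset.sum_congr rfl fun x _ => ?_
      split_ifs with hx
      · simp [eq_zero_of_classicalMarginal (hτ x) hx, trPair]
      · rfl
    have h3 : ∑ x, trPair σ (if p x = 0 then ε • 1 else ∑ s, W x s • c x s • Ω s) ≤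
        ∑ x, (ε + ∑ s, (W x s * p x / p' s) * trPair σ (Ω s)) := by
      refine Finset.sum_le_sum fun x _ => ?_
      have hnn : ∀ s, 0 ≤ (W x s * p x / p' s) * trPair σ (Ω s) := fun s =>
        mul_nonneg (div_nonneg (mul_nonneg ((hW x).1 s) (hp0 x)) (hp0' s))
          (trPair_nonneg hσ.1 (hΩ s).posSemidef)
      split_ifs with hx
      · rw [trPair_smul, trPair_one, hσ.trace_re, mul_one]
        have := Finset.sum_nonneg fun s (_ : s ∈ Finset.univ) => hnn s
        linarith
      · have : trPair σ (∑ s, W x s • c x s • Ω s) =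
            ∑ s, (W x s * p x / p' s) * trPair σ (Ω s) := by
          simp only [trPair_sum, trPair_smul]
          refine Finset.sum_congr rfl fun s _ => ?_
          by_cases hs : p' s = 0
          · simp [hWz x s hx hs]
          · simp only [c, if_neg hs]; ring
        rw [this]
        linarith
    have h4 : ∑ x, (ε + ∑ s, (W x s * p x / p' s) * trPair σ (Ω s)) ≤
        ∑ s, trPair σ (Ω s) + ε * Fintype.card X := by
      rw [Finset.sum_add_distrib, Finset.sum_comm, Finset.sum_const, Finset.card_univ,
        nsmul_eq_mul, add_comm, mul_comm ε]
      refine add_le_add (Finset.sum_le_sum fun s _ => ?_) le_rfl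
      rw [← Finset.sum_mul, ← Finset.sum_div, ← hpp' s]
      refine mul_le_of_le_one_left (trPair_nonneg hσ.1 (hΩ s).posSemidef) (div_self_le_one _)
    rw [h2] at h1
    linarith
  have hlim : ∑ x, (if p x = 0 then 0 else
        trPair (τ x) (cfc Real.log (∑ s, W x s • c x s • Ω s))) ≤
      z - -∑ x, p x * Real.log (p x) + ∑ s, trPair σ (Ω s) - 1 := by
    refine le_of_forall_pos_le_add fun δ hδ => ?_
    have h1 := hmain (δ / (1 + Fintype.card X)) (by positivity)
    have h2 : δ / (1 + Fintype.card X) * Fintype.card X ≤ δ := by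
      rw [div_mul_eq_mul_div, div_le_iff₀ (by positivity)]
      nlinarith
    linarith
  have hsum := Finset.sum_le_sum fun x (_ : x ∈ Finset.univ) => hterm x
  rw [Finset.sum_sub_distrib, Finset.sum_add_distrib, Finset.sum_comm,
    Finset.sum_comm (f := fun x s => W x s * p x * Real.log (p' s))] at hsum
  have e1 : ∑ s, ∑ x, W x s * trPair (τ x) (cfc Real.log (Ω s)) =
      ∑ s, trPair (postProcess W τ s) (cfc Real.log (Ω s)) := by
    refine Finset.sum_congr rfl fun s _ => ?_
    rw [postProcess, trPair_sum_left]
    exact Finset.sum_congr rfl fun x _ => (trPair_smul_left _ _ _).symm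
  have e2 : ∑ s, ∑ x, W x s * p x * Real.log (p' s) = ∑ s, p' s * Real.log (p' s) := by
    refine Finset.sum_congr rfl fun s _ => ?_
    rw [← Finset.sum_mul, ← hpp' s]
  rw [e1, e2] at hsum
  linarith

theorem markovEnsemble_eq_postProcess (W : X → S → ℝ) (p : X → ℝ) (ρ : X → Matrix B B ℂ) :
    markovEnsemble W p ρ = postProcess W (ensemble p ρ) := by
  funext s
  simp only [markovEnsemble, postProcess, ensemble]
  refine Finset.sum_congr rfl fun x _ => ?_
  rw [Complex.ofReal_mul, mul_smul]
  rfl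

theorem ensemble_posSemidef {p : X → ℝ} (hp : ∀ x, 0 ≤ p x) {ρ : X → Matrix B B ℂ}
    (hρ : ∀ x, IsDensity (ρ x)) (x : X) : (ensemble p ρ x).PosSemidef :=
  (hρ x).1.smul (α := ℂ) (by exact_mod_cast hp x)

theorem classicalMarginal_ensemble (p : X → ℝ) {ρ : X → Matrix B B ℂ}
    (hρ : ∀ x, IsDensity (ρ x)) : classicalMarginal (ensemble p ρ) = p := by
  funext x
  simp [classicalMarginal, ensemble, (hρ x).2]

theorem maxArimotoInfo_one_eq {p : X → ℝ} (hp : p ∈ stdSimplex ℝ X) {ρ : X → Matrix B B ℂ}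
    (hρ : ∀ x, IsDensity (ρ x)) :
    maxArimotoInfo 1 p ρ = arimotoInfo 1 (ensemble p ρ) := by
  have hτ := ensemble_posSemidef hp.1 hρ
  have htr : ∑ x, classicalMarginal (ensemble p ρ) x = 1 := by
    rw [classicalMarginal_ensemble p hρ, hp.2]
  refine le_antisymm (iSup_le fun n => iSup₂_le fun W hW => ?_) ?_
  · rw [markovEnsemble_eq_postProcess]
    exact arimotoInfo_one_postProcess_le hW hτ htr
  -- The chain `S = X`, relabelled by `Fin`, attains the value: data processing along the inverse
  -- relabelling gives the reverse inequality.
  · let e := Fintype.equivFin X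
    let W : X → Fin (Fintype.card X) → ℝ := fun x => Pi.single (e x) 1
    let V : Fin (Fintype.card X) → X → ℝ := fun i => Pi.single (e.symm i) 1
    have hW : ∀ x, W x ∈ stdSimplex ℝ (Fin (Fintype.card X)) := fun x =>
      single_mem_stdSimplex ℝ _
    have hV : ∀ i, V i ∈ stdSimplex ℝ X := fun i => single_mem_stdSimplex ℝ _
    refine le_trans ?_ (le_iSup_of_le (Fintype.card X) (le_iSup₂_of_le W hW le_rfl))
    rw [markovEnsemble_eq_postProcess]
    have hback : postProcess V (postProcess W (ensemble p ρ)) = ensemble p ρ := by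
      funext x
      simp only [postProcess]
      rw [Finset.sum_eq_single (e x)]
      · rw [Finset.sum_eq_single x]
        · simp [V, W]
        · intro y _ hy
          simp [W, hy.symm]
        · simp
      · intro i _ hi
        have : x ≠ e.symm i := fun h => hi (by simp [h])
        simp [V, this]
      · simp
    have := arimotoInfo_one_postProcess_le hV (postProcess_posSemidef hW hτ)
      (by rw [sum_classicalMarginal_postProcess hW, htr])
    rwa [hback] at this

theorem maxLeakage_eq_maxArimotoInfo {α : ℝ≥0∞} (h1 : 1 ≤ α) {p : X → ℝ}
    (hp : p ∈ stdSimplex ℝ X) {ρ : X → Matrix B B ℂ} (hρ : ∀ x, IsDensity (ρ x)) :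
    maxLeakage α p ρ = maxArimotoInfo α p ρ := by
  unfold maxLeakage maxArimotoInfo markovSup
  refine iSup_congr fun n => iSup_congr fun W => iSup_congr fun hW => ?_
  rw [markovEnsemble_eq_postProcess]
  refine leakage_eq_arimotoInfo h1
    (postProcess_posSemidef hW (ensemble_posSemidef hp.1 hρ)) ?_
  rw [sum_classicalMarginal_postProcess hW, classicalMarginal_ensemble p hρ, hp.2]

end DataProcessing

/-! ### Scalar Hölder inequality and discretization -/

section Scalar

variable {X : Type*} [Fintype X]

/-- Hölder, obtained from weighted AM–GM after normalizing `g`. It controls the entropy of the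
tilted distribution proportional to `q ^ (1 - β)`. -/
theorem sum_rpow_mul_rpow_le {β : ℝ} (hβ0 : 0 < β) (hβ1 : β ≤ 1) {q g : X → ℝ}
    (hq : q ∈ stdSimplex ℝ X) (hg : ∀ x, 0 ≤ g x) :
    ∑ x, q x ^ (1 - β) * g x ^ β ≤ (∑ x, g x) ^ β := by
  rcases (Finset.sum_nonneg fun x (_ : x ∈ Finset.univ) => hg x).eq_or_lt with h | h
  · have hz := (Finset.sum_eq_zero_iff_of_nonneg fun i _ => hg i).1 h.symm
    rw [← h, Real.zero_rpow hβ0.ne']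
    refine (Finset.sum_eq_zero fun i hi => ?_).le
    rw [hz i hi, Real.zero_rpow hβ0.ne', mul_zero]
  · set G := ∑ x, g x with hG
    have key : ∀ x, q x ^ (1 - β) * (g x / G) ^ β ≤ (1 - β) * q x + β * (g x / G) := fun x =>
      Real.geom_mean_le_arith_mean2_weighted (by linarith) hβ0.le (hq.1 x)
        (div_nonneg (hg x) h.le) (by ring)
    have hsum := Finset.sum_le_sum fun x (_ : x ∈ Finset.univ) => key x
    rw [Finset.sum_add_distrib, ← Finset.mul_sum, ← Finset.mul_sum, hq.2, ← Finset.sum_div, ← hG,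
      div_self h.ne'] at hsum
    have e : ∀ x, q x ^ (1 - β) * (g x / G) ^ β = q x ^ (1 - β) * g x ^ β / G ^ β := fun x => by
      rw [Real.div_rpow (hg x) h.le, mul_div_assoc]
    simp only [e] at hsum
    rw [← Finset.sum_div, div_le_iff₀ (Real.rpow_pos_of_pos h _)] at hsum
    linarith

/-- The equation `p k ^ (-β) = t v` has the real solution `k = K (p / v) ^ (1 / β)` with `t = K ^
(-β)`; for `K` large, rounding up changes `k` by a factor at most `1 + ε`. -/
theorem exists_nat_discretization {β : ℝ} (hβ0 : 0 < β) (hβ1 : β ≤ 1) {p v : X → ℝ}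
    (hp : ∀ x, 0 < p x) (hv : ∀ x, 0 < v x) {ε : ℝ} (hε : 0 < ε) :
    ∃ (t : ℝ) (k : X → ℕ), 0 < t ∧ ∀ x, 0 < k x ∧ p x * ((k x : ℝ)⁻¹) ^ β ≤ t * v x ∧
      t * v x ≤ (1 + ε) * (p x * ((k x : ℝ)⁻¹) ^ β) := by
  let c : X → ℝ := fun x => (p x / v x) ^ β⁻¹
  have hc : ∀ x, 0 < c x := fun x => Real.rpow_pos_of_pos (div_pos (hp x) (hv x)) _
  have hcβ : ∀ x, c x ^ β = p x / v x := fun x => by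
    rw [← Real.rpow_mul (div_pos (hp x) (hv x)).le, inv_mul_cancel₀ hβ0.ne', Real.rpow_one]
  obtain ⟨K, hK0, hK⟩ : ∃ K : ℕ, 0 < K ∧ ∀ x, 1 ≤ K * c x * ε := by
    obtain ⟨K, hK⟩ := exists_nat_ge (∑ x, (c x * ε)⁻¹)
    refine ⟨K + 1, by omega, fun x => ?_⟩
    have h1 : (c x * ε)⁻¹ ≤ K := le_trans (Finset.single_le_sum
      (f := fun x => (c x * ε)⁻¹) (fun y _ => by have := hc y; positivity) (Finset.mem_univ x)) hK
    have h2 : 0 < c x * ε := mul_pos (hc x) hε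
    rw [inv_le_iff_one_le_mul₀ h2] at h1
    push_cast
    nlinarith
  have hK0' : (0 : ℝ) < K := by exact_mod_cast hK0
  refine ⟨((K : ℝ)⁻¹) ^ β, fun x => ⌈K * c x⌉₊, by positivity, fun x => ?_⟩
  have hKc : 0 < K * c x := mul_pos hK0' (hc x)
  have hk0 : 0 < ⌈K * c x⌉₊ := Nat.ceil_pos.2 hKc
  have hk0' : (0 : ℝ) < (⌈K * c x⌉₊ : ℝ) := by exact_mod_cast hk0
  have hlow : K * c x ≤ (⌈K * c x⌉₊ : ℝ) := Nat.le_ceil _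
  have hup : (⌈K * c x⌉₊ : ℝ) ≤ K * c x * (1 + ε) := by
    have := (Nat.ceil_lt_add_one hKc.le).le
    have := hK x
    linarith
  have e : ((K * c x)⁻¹) ^ β = ((K : ℝ)⁻¹) ^ β * (v x / p x) := by
    rw [mul_inv, Real.mul_rpow (by positivity) (inv_nonneg.2 (hc x).le), Real.inv_rpow (hc x).le,
      hcβ, inv_div]
  have hpx := hp x
  refine ⟨hk0, ?_, ?_⟩
  · have h1 : ((⌈K * c x⌉₊ : ℝ)⁻¹) ^ β ≤ ((K * c x)⁻¹) ^ β :=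
      Real.rpow_le_rpow (by positivity) (inv_anti₀ hKc hlow) hβ0.le
    rw [e] at h1
    refine (mul_le_mul_of_nonneg_left h1 hpx.le).trans (le_of_eq ?_)
    field_simp
  · have h1 : ((K * c x * (1 + ε))⁻¹) ^ β ≤ ((⌈K * c x⌉₊ : ℝ)⁻¹) ^ β :=
      Real.rpow_le_rpow (by positivity) (inv_anti₀ hk0' hup) hβ0.le
    rw [mul_inv, Real.mul_rpow (by positivity) (by positivity), e, Real.inv_rpow (show 0 ≤ 1 + ε by positivity)]
      at h1
    have h2 : (1 + ε) ^ β ≤ 1 + ε := by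
      simpa using Real.rpow_le_rpow_of_exponent_le (show (1 : ℝ) ≤ 1 + ε by linarith) hβ1
    have h3 : (1 + ε)⁻¹ ≤ ((1 + ε) ^ β)⁻¹ := inv_anti₀ (by positivity) h2
    have hvx := hv x
    have h4 : ((K : ℝ)⁻¹) ^ β * (v x / p x) * (1 + ε)⁻¹ ≤ ((⌈K * c x⌉₊ : ℝ)⁻¹) ^ β :=
      le_trans (mul_le_mul_of_nonneg_left h3 (by positivity)) h1
    have h5 := mul_le_mul_of_nonneg_left h4 (show 0 ≤ (1 + ε) * p x by positivity)
    refine le_trans (le_of_eq ?_) (h5.trans (le_of_eq ?_))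
    · field_simp
    · ring

end Scalar

/-! ### Capacities and the divergence radius -/

section Radius

variable {X B : Type*} [Fintype X] [DecidableEq X] [Fintype B] [DecidableEq B]

theorem exists_of_divergenceRadius_lt {α : ℝ≥0∞} {X : Type*} {N : X → Matrix B B ℂ} {z : ℝ}
    (h : divergenceRadius α N < z) :
    ∃ σ : Matrix B B ℂ, IsDensity σ ∧ ∀ x, measuredDiv α (N x) σ ≤ z := by
  by_contra! hcon
  refine absurd h (not_lt.2 (le_iInf₂ fun σ hσ => ?_))
  obtain ⟨x, hx⟩ := hcon σ hσ
  exact hx.le.trans (le_iSup (fun x => measuredDiv α (N x) σ) x)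

theorem exists_lt_measuredDiv {α : ℝ≥0∞} {X : Type*} {N : X → Matrix B B ℂ} {z : ℝ}
    (h : z < divergenceRadius α N) {σ : Matrix B B ℂ} (hσ : IsDensity σ) :
    ∃ x, z < measuredDiv α (N x) σ :=
  lt_iSup_iff.1 (h.trans_le (iInf₂_le σ hσ))

/-- The bound for each `ρ x` is linear in the state and so survives mixing; the entropy formula at
`g s = Tr σ Ω_s` then sums over `s`. Only pairs of nonzero weight matter, which is why just the
support of `p` enters later. -/
theorem arimotoInfo_le_of_mixture {S : Type*} [Fintype S] [DecidableEq S] {α : ℝ≥0∞} (h1 : 1 < α)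
    {ρ : X → Matrix B B ℂ} (hρ : ∀ x, IsDensity (ρ x)) {W : S → X → ℝ} (hW : ∀ s x, 0 ≤ W s x)
    (hW1 : ∑ s, ∑ x, W s x = 1) {σ : Matrix B B ℂ} (hσ : IsDensity σ) {z : ℝ}
    (h : ∀ s x, W s x ≠ 0 → measuredDiv α (ρ x) σ ≤ z) :
    arimotoInfo α (fun s => ∑ x, W s x • ρ x) ≤ z := by
  have hβ := gainExponent_pos h1
  have h0 := hβ.ne'
  have hτ : ∀ s, (∑ x, W s x • ρ x).PosSemidef := fun s =>
    posSemidef_sum _ fun x _ => (hρ x).1.smul (hW s x)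
  have hm : classicalMarginal (fun s => ∑ x, W s x • ρ x) = fun s => ∑ x, W s x := by
    funext s
    simp [classicalMarginal, Matrix.trace_sum, (hρ _).2]
  refine arimotoInfo_le hσ ?_
  rw [measuredDiv_cqOp_le_iff h1.le hτ (fun _ => hσ.1) (fun h => absurd h h1.ne'), hm]
  have hent := (neg_renyiEntropy_le_iff h1.le (p := fun s => ∑ x, W s x)
    (fun s => Finset.sum_nonneg fun x _ => hW s x) hW1 _).1 le_rfl
  simp only [bnd, if_neg h0] at hent ⊢
  simp only [PhiDom, phi, if_neg h0] at hent
  intro Ω hΩ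
  have hΩ0 : ∀ s, 0 ≤ trPair σ (Ω s) := fun s => trPair_nonneg hσ.1 (hΩ s).posSemidef
  have hent' := hent (fun s => trPair σ (Ω s)) hΩ0
  have hle : ∀ s, trPair (∑ x, W s x • ρ x) (cfc (phi (gainExponent α)) (Ω s)) ≤
      Real.exp (gainExponent α * z) *
        ((∑ x, W s x) * trPair σ (Ω s) ^ gainExponent α) := by
    intro s
    rw [trPair_sum_left, Finset.sum_mul, Finset.mul_sum]
    refine Finset.sum_le_sum fun x _ => ?_
    rw [trPair_smul_left]
    by_cases hw : W s x = 0
    · simp [hw]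
    · have := h s x hw
      rw [measuredDiv_le_iff h1.le (hρ x).1 hσ.1 (fun h => absurd h h1.ne')] at this
      have h2 := mul_le_mul_of_nonneg_left (this (Ω s) (hΩ s)) (hW s x)
      rw [bnd, if_neg h0] at h2
      linarith
  refine (Finset.sum_le_sum fun s _ => hle s).trans ?_
  rw [← Finset.mul_sum, mul_sub, sub_eq_add_neg, Real.exp_add, mul_assoc, ← mul_neg]
  exact mul_le_mul_of_nonneg_left hent' (Real.exp_pos _).le

/-- The per-input bounds are averaged with weights `q`, and concavity of `t ^ β` moves the average
inside the power. -/
theorem measuredInfo_le_of_forall {α : ℝ≥0∞} (h1 : 1 < α) {ρ : X → Matrix B B ℂ}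
    (hρ : ∀ x, IsDensity (ρ x)) {q : X → ℝ} (hq : q ∈ stdSimplex ℝ X) {σ : Matrix B B ℂ}
    (hσ : IsDensity σ) {z : ℝ} (h : ∀ x, measuredDiv α (ρ x) σ ≤ z) :
    measuredInfo α (ensemble q ρ) ≤ z := by
  have hβ := gainExponent_pos h1
  have h0 := hβ.ne'
  refine iInf₂_le_of_le σ hσ ?_
  rw [marginalOp_kronecker_eq_cqOp, classicalMarginal_ensemble q hρ,
    measuredDiv_cqOp_le_iff h1.le (ensemble_posSemidef hq.1 hρ)
      (fun x => hσ.1.smul (α := ℂ) (by exact_mod_cast hq.1 x)) (fun h => absurd h h1.ne')]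
  intro Ω hΩ
  simp only [bnd, if_neg h0, ensemble, trPair_ofReal_smul_left]
  have hle : ∀ x, q x * trPair (ρ x) (cfc (phi (gainExponent α)) (Ω x)) ≤
      Real.exp (gainExponent α * z) * (q x * trPair σ (Ω x) ^ gainExponent α) := by
    intro x
    have := h x
    rw [measuredDiv_le_iff h1.le (hρ x).1 hσ.1 (fun h => absurd h h1.ne')] at this
    have h2 := mul_le_mul_of_nonneg_left (this (Ω x) (hΩ x)) (hq.1 x)
    rw [bnd, if_neg h0] at h2
    linarith
  refine (Finset.sum_le_sum fun x _ => hle x).trans ?_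
  rw [← Finset.mul_sum]
  refine mul_le_mul_of_nonneg_left ?_ (Real.exp_pos _).le
  have := (Real.concaveOn_rpow hβ.le (gainExponent_mem h1.le).2).le_map_sum
    (t := Finset.univ) (w := q) (p := fun x => trPair σ (Ω x)) (fun x _ => hq.1 x) hq.2
    (fun x _ => trPair_nonneg hσ.1 (hΩ x).posSemidef)
  simpa using this

theorem exists_input_of_lt_divergenceRadius {α : ℝ≥0∞} (h1 : 1 < α) {N : X → Matrix B B ℂ}
    (hN : ∀ x, IsDensity (N x)) [Nonempty B] {z : ℝ} (hz : z < divergenceRadius α N) :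
    ∃ q ∈ stdSimplex ℝ X, ∃ Ω : X → Matrix B B ℂ, (∀ x, (Ω x).PosSemidef) ∧
      ∀ σ : Matrix B B ℂ, IsDensity σ →
        Real.exp (gainExponent α * z) * (∑ x, q x * trPair σ (Ω x)) ^ gainExponent α <
          ∑ x, q x * trPair (N x) (cfc (phi (gainExponent α)) (Ω x)) := by
  have h0 := (gainExponent_pos h1).ne'
  have hβI := gainExponent_mem h1.le
  obtain ⟨q, hq, Ω, hΩ, hlt⟩ := exists_uniform_channel hβI (fun x => (hN x).1) z (by
    intro σ hσ
    obtain ⟨x, hx⟩ := exists_lt_measuredDiv hz hσ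
    have := hx.not_ge
    rw [measuredDiv_le_iff h1.le (hN x).1 hσ.1 (fun h => absurd h h1.ne')] at this
    push Not at this
    exact ⟨x, this⟩)
  refine ⟨q, hq, Ω, fun x => (hΩ x).posSemidef, fun σ hσ => ?_⟩
  have := (bnd_le_affine hβI z (Finset.sum_nonneg fun x (_ : x ∈ Finset.univ) =>
    mul_nonneg (hq.1 x) (trPair_nonneg hσ.1 (hΩ x).posSemidef))).trans_lt (hlt σ hσ)
  rwa [bnd, if_neg h0] at this

/-- The hypothesis on `K` says that `K` is at least `exp (-β H_α)`, so a violation with factor `K`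
defeats every `σ` in the definition of the Arimoto information. -/
theorem le_arimotoInfo_of_family {α : ℝ≥0∞} (h1 : 1 < α) {τ : X → Matrix B B ℂ}
    (hτ : ∀ x, (τ x).PosSemidef) (htr : ∑ x, classicalMarginal τ x = 1) {K z : ℝ} (hK : 0 < K)
    (hp : ∀ g : X → ℝ, (∀ x, 0 ≤ g x) → ∑ x, classicalMarginal τ x * g x ^ gainExponent α ≤
      K * (∑ x, g x) ^ gainExponent α)
    {Ω : X → Matrix B B ℂ} (hΩ : ∀ x, (Ω x).PosSemidef)
    (h : ∀ σ : Matrix B B ℂ, IsDensity σ →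
      Real.exp (gainExponent α * z) * K * (∑ x, trPair σ (Ω x)) ^ gainExponent α <
        ∑ x, trPair (τ x) (cfc (phi (gainExponent α)) (Ω x))) :
    z ≤ arimotoInfo α τ := by
  have hβ := gainExponent_pos h1
  have h0 := hβ.ne'
  by_contra! hlt
  obtain ⟨σ, hσ, hD⟩ := exists_of_arimotoInfo_lt hlt
  rw [measuredDiv_cqOp_le_iff h1.le hτ (fun _ => hσ.1) (fun h => absurd h h1.ne')] at hD
  have h2 := hD Ω fun x => by simpa [MatDom, h0] using hΩ x
  rw [bnd, if_neg h0] at h2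
  have hent := (neg_renyiEntropy_le_iff h1.le (classicalMarginal_nonneg hτ) htr
    ((gainExponent α)⁻¹ * Real.log K)).2 (by
      intro g hg
      simp only [phi, bnd, if_neg h0]
      rw [← mul_assoc, mul_inv_cancel₀ h0, one_mul, Real.exp_log hK]
      exact hp g fun x => (hg x).nonneg)
  rw [le_inv_mul_iff₀ hβ, Real.le_log_iff_exp_le hK] at hent
  refine absurd (h σ hσ) (not_lt.2 (h2.trans ?_))
  refine mul_le_mul_of_nonneg_right ?_ (Real.rpow_nonneg
    (Finset.sum_nonneg fun x _ => trPair_nonneg hσ.1 (hΩ x)) _)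
  rw [mul_sub, sub_eq_add_neg, Real.exp_add, ← mul_neg]
  exact mul_le_mul_of_nonneg_left hent (Real.exp_pos _).le

theorem measuredCapacity_eq_divergenceRadius {α : ℝ≥0∞} (h1 : 1 < α) {N : X → Matrix B B ℂ}
    (hN : ∀ x, IsDensity (N x)) [Nonempty B] :
    measuredCapacity α N = divergenceRadius α N := by
  have h0 := (gainExponent_pos h1).ne'
  refine le_antisymm (ereal_le_of_forall_real_lt fun z hz => ?_)
    (ereal_le_of_forall_real_lt fun z hz => ?_)
  · obtain ⟨σ, hσ, h⟩ := exists_of_divergenceRadius_lt hz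
    exact iSup₂_le fun q hq => measuredInfo_le_of_forall h1 hN hq hσ h
  · by_contra! hlt
    obtain ⟨q, hq, Ω, hΩ, h⟩ := exists_input_of_lt_divergenceRadius h1 hN hlt
    have hqz : measuredInfo α (ensemble q N) < z :=
      (le_iSup₂ (f := fun q (_ : q ∈ stdSimplex ℝ X) => measuredInfo α (ensemble q N)) q hq).trans_lt
        hz
    unfold measuredInfo at hqz
    simp only [iInf_lt_iff] at hqz
    obtain ⟨σ, hσ, hD⟩ := hqz
    have hD' := hD.le
    rw [marginalOp_kronecker_eq_cqOp, classicalMarginal_ensemble q hN,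
      measuredDiv_cqOp_le_iff h1.le (ensemble_posSemidef hq.1 hN)
        (fun x => hσ.1.smul (α := ℂ) (by exact_mod_cast hq.1 x)) (fun h => absurd h h1.ne')] at hD'
    have := hD' Ω fun x => by simpa [MatDom, h0] using hΩ x
    simp only [bnd, if_neg h0, ensemble, trPair_ofReal_smul_left] at this
    exact absurd (h σ hσ) (not_lt.2 this)

theorem arimotoCapacity_eq_divergenceRadius {α : ℝ≥0∞} (h1 : 1 < α) {N : X → Matrix B B ℂ}
    (hN : ∀ x, IsDensity (N x)) [Nonempty B] :
    arimotoCapacity α N = divergenceRadius α N := by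
  have hβ := gainExponent_pos h1
  have h0 := hβ.ne'
  have hβ1 := (gainExponent_mem h1.le).2
  refine le_antisymm (ereal_le_of_forall_real_lt fun z hz => ?_)
    (ereal_le_of_forall_real_lt fun z hz => ?_)
  · obtain ⟨σ, hσ, h⟩ := exists_of_divergenceRadius_lt hz
    refine iSup₂_le fun q hq => ?_
    have := arimotoInfo_le_of_mixture (S := X) (W := fun s => Pi.single s (q s)) h1 hN
      (fun s x => by
        by_cases hx : x = s
        · subst hx; simpa using hq.1 x
        · simp [hx])
      (by simpa using hq.2) hσ (fun _ x _ => h x)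
    have he : (fun s => ∑ x, (Pi.single s (q s) : X → ℝ) x • N x) = ensemble q N := by
      funext s
      rw [Finset.sum_eq_single s]
      · simp [ensemble]
      · intro x _ hx; simp [hx]
      · simp
    rwa [he] at this
  · by_contra! hlt
    obtain ⟨q, hq, Ω, hΩ, h⟩ := exists_input_of_lt_divergenceRadius h1 hN hlt
    set β := gainExponent α
    -- With input `u / Z` and test operators `q x • Ω x`, the identity `q ^ (1 - β) * q ^ β = q`
    -- restores the weights `q` on both sides of the violated inequality, with `K = 1 / Z`.
    let u : X → ℝ := fun x => q x ^ (1 - β)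
    have hu0 : ∀ x, 0 ≤ u x := fun x => Real.rpow_nonneg (hq.1 x) _
    have hZ : 0 < ∑ x, u x := by
      obtain ⟨i, hi⟩ : ∃ i, 0 < q i := by
        by_contra! hcon
        have := Finset.sum_nonpos fun i (_ : i ∈ Finset.univ) => hcon i
        rw [hq.2] at this
        linarith
      exact Finset.sum_pos' (fun x _ => hu0 x)
        ⟨i, Finset.mem_univ _, Real.rpow_pos_of_pos hi _⟩
    set Z := ∑ x, u x with hZdef
    have hpu : (fun x => u x / Z) ∈ stdSimplex ℝ X :=
      ⟨fun x => div_nonneg (hu0 x) hZ.le, by rw [← Finset.sum_div, ← hZdef, div_self hZ.ne']⟩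
    refine absurd (lt_of_le_of_lt (le_iSup₂
      (f := fun q (_ : q ∈ stdSimplex ℝ X) => arimotoInfo α (ensemble q N)) _ hpu) hz)
      (not_lt.2 (le_arimotoInfo_of_family h1 (ensemble_posSemidef hpu.1 hN) ?_
        (inv_pos.2 hZ) ?_ (Ω := fun x => q x • Ω x) (fun x => (hΩ x).smul (hq.1 x)) ?_))
    · rw [classicalMarginal_ensemble _ hN, hpu.2]
    · intro g hg
      rw [classicalMarginal_ensemble _ hN]
      have := mul_le_mul_of_nonneg_left (sum_rpow_mul_rpow_le hβ hβ1 hq hg) (inv_pos.2 hZ).le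
      refine le_trans (le_of_eq ?_) this
      rw [Finset.mul_sum]
      refine Finset.sum_congr rfl fun x _ => ?_
      simp only [u]
      ring
    · intro σ hσ
      simp only [ensemble, trPair_ofReal_smul_left, trPair_smul]
      have h2 := mul_lt_mul_of_pos_left (h σ hσ) (inv_pos.2 hZ)
      refine lt_of_eq_of_lt ?_ (h2.trans_le (le_of_eq ?_))
      · ring
      · rw [Finset.mul_sum]
        refine Finset.sum_congr rfl fun x _ => ?_
        rw [cfc_phi_smul_of_ne h0 (hΩ x) (hq.1 x), trPair_smul]
        have hqq : q x ^ (1 - β) * q x ^ β = q x := by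
          rcases (hq.1 x).eq_or_lt with hx | hx
          · rw [← hx, Real.zero_rpow h0, mul_zero]
          · rw [← Real.rpow_add hx, sub_add_cancel, Real.rpow_one]
        simp only [u]
        calc Z⁻¹ * (q x * trPair (N x) (cfc (phi β) (Ω x))) =
            Z⁻¹ * ((q x ^ (1 - β) * q x ^ β) * trPair (N x) (cfc (phi β) (Ω x))) := by rw [hqq]
          _ = _ := by ring

end Radius

/-! ### Markov chains attain the divergence radius -/

section Markov

variable {X B : Type*} [Fintype X] [DecidableEq X] [Fintype B] [DecidableEq B]

theorem trPair_cfc_phi_nonneg {β : ℝ} (hβ : β ≠ 0) {ρ A : Matrix B B ℂ} (hρ : ρ.PosSemidef)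
    (hA : A.PosSemidef) : 0 ≤ trPair ρ (cfc (phi β) A) := by
  obtain ⟨E, hE, h⟩ := exists_spectral_povm hA.isHermitian
  rw [h, trPair_sum]
  refine Finset.sum_nonneg fun i _ => ?_
  rw [trPair_smul, phi_of_ne hβ]
  exact mul_nonneg (Real.rpow_nonneg (hA.eigenvalues_nonneg i) _) (trPair_nonneg hρ (hE.1 i))

theorem maxArimotoInfo_le_divergenceRadius {α : ℝ≥0∞} (h1 : 1 < α) {p : X → ℝ}
    (hp : p ∈ stdSimplex ℝ X) {ρ : X → Matrix B B ℂ} (hρ : ∀ x, IsDensity (ρ x)) :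
    maxArimotoInfo α p ρ ≤ divergenceRadius α (restrictSupp p ρ) := by
  refine ereal_le_of_forall_real_lt fun z hz => ?_
  obtain ⟨σ, hσ, h⟩ := exists_of_divergenceRadius_lt hz
  refine iSup_le fun n => iSup₂_le fun W hW => ?_
  exact arimotoInfo_le_of_mixture (W := fun s x => W x s * p x) h1 hρ
    (fun s x => mul_nonneg ((hW x).1 s) (hp.1 x))
    (by
      rw [Finset.sum_comm, ← hp.2]
      refine Finset.sum_congr rfl fun x _ => ?_
      rw [← Finset.sum_mul, (hW x).2, one_mul])
    hσ (fun s x hx => h ⟨x, right_ne_zero_of_mul hx⟩)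

/-- Splitting each symbol `x` in the support of `p` uniformly into `k x` symbols. -/
theorem exists_uniform_splitting {p : X → ℝ} (hp : p ∈ stdSimplex ℝ X) (ρ : X → Matrix B B ℂ)
    {k : {x // p x ≠ 0} → ℕ} (hk : ∀ x, 0 < k x) :
    ∃ (n : ℕ) (W : X → Fin n → ℝ) (e : Fin n ≃ Σ x : {x // p x ≠ 0}, Fin (k x)),
      (∀ x, W x ∈ stdSimplex ℝ (Fin n)) ∧ ∀ i, markovEnsemble W p ρ i =
        (p (e i).1 * (k (e i).1 : ℝ)⁻¹) • restrictSupp p ρ (e i).1 := by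
  classical
  let S := Σ x : {x // p x ≠ 0}, Fin (k x)
  let e : Fin (Fintype.card S) ≃ S := (Fintype.equivFin S).symm
  obtain ⟨x₀, hx₀⟩ : ∃ x, p x ≠ 0 := by
    by_contra! hcon
    have := hp.2
    simp [hcon] at this
  let i₀ : Fin (Fintype.card S) := e.symm ⟨⟨x₀, hx₀⟩, ⟨0, hk _⟩⟩
  -- Inputs outside the support do not affect the state; they go to the fixed symbol `i₀` only so
  -- that `W` is stochastic.
  let W : X → Fin (Fintype.card S) → ℝ := fun x i =>
    if p x = 0 then (Pi.single i₀ 1 : Fin (Fintype.card S) → ℝ) i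
    else if ((e i).1 : X) = x then (k (e i).1 : ℝ)⁻¹ else 0
  refine ⟨Fintype.card S, W, e, fun x => ?_, fun i => ?_⟩
  · by_cases hx : p x = 0
    · have : W x = Pi.single i₀ 1 := by funext i; simp [W, hx]
      rw [this]
      exact single_mem_stdSimplex ℝ _
    · refine ⟨fun i => ?_, ?_⟩
      · simp only [W, if_neg hx]
        split_ifs <;> positivity
      · simp only [W, if_neg hx]
        rw [Equiv.sum_comp e (fun s : S => if (s.1 : X) = x then (k s.1 : ℝ)⁻¹ else 0),
          Fintype.sum_sigma, Finset.sum_eq_single (⟨x, hx⟩ : {x // p x ≠ 0})]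
        · have : (k ⟨x, hx⟩ : ℝ) ≠ 0 := by exact_mod_cast (hk ⟨x, hx⟩).ne'
          simp [this]
        · intro y _ hy
          have : (y : X) ≠ x := fun h => hy (Subtype.ext h)
          simp [this]
        · simp
  · rw [markovEnsemble, Finset.sum_eq_single ((e i).1 : X)]
    · have hx := (e i).1.2
      simp only [W, if_neg hx, if_true, restrictSupp]
      rw [mul_comm]
      rfl
    · intro x _ hx
      by_cases hpx : p x = 0
      · simp [hpx]
      · simp [W, hpx, Ne.symm hx]
    · simp

/-- Although `p` is fixed, uniform splitting of symbols imitates the tilted input: spreading mass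
over `k x` symbols contributes an effective weight `p x * (k x) ^ (-β)`, made close to a multiple of
`q x ^ (1 - β)`. -/
theorem divergenceRadius_le_maxArimotoInfo {α : ℝ≥0∞} (h1 : 1 < α) {p : X → ℝ}
    (hp : p ∈ stdSimplex ℝ X) {ρ : X → Matrix B B ℂ} (hρ : ∀ x, IsDensity (ρ x)) [Nonempty B] :
    divergenceRadius α (restrictSupp p ρ) ≤ maxArimotoInfo α p ρ := by
  classical
  have hβ := gainExponent_pos h1
  have h0 := hβ.ne'
  have hβ1 := (gainExponent_mem h1.le).2
  refine ereal_le_of_forall_real_lt fun z hz => ?_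
  by_contra! hlt
  obtain ⟨z', hzz', hz'⟩ := EReal.lt_iff_exists_real_btwn.1 hlt
  rw [EReal.coe_lt_coe_iff] at hzz'
  have hN : ∀ x, IsDensity (restrictSupp p ρ x) := fun x => hρ x
  obtain ⟨q, hq, Ω, hΩ, h⟩ := exists_input_of_lt_divergenceRadius h1 hN hz'
  set β := gainExponent α
  set N := restrictSupp p ρ
  -- The gap between `z` and `z'` pays for two factors `1 + ε`: one from smoothing by `δ`, one from
  -- rounding.
  obtain ⟨ε, hε, hεz⟩ : ∃ ε : ℝ, 0 < ε ∧
      Real.exp (β * z) * (1 + ε) * (1 + ε) ≤ Real.exp (β * z') := by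
    refine ⟨Real.exp (β * (z' - z) / 2) - 1, ?_, le_of_eq ?_⟩
    · have : 0 < β * (z' - z) / 2 := by have := sub_pos.2 hzz'; positivity
      have := Real.one_lt_exp_iff.2 this
      linarith
    · rw [add_sub_cancel, ← Real.exp_add, ← Real.exp_add]
      congr 1; ring
  set c : ℝ := (Fintype.card {x // p x ≠ 0} : ℝ) with hc
  let δ : ℝ := ε / (1 + c)
  have hc0 : 0 ≤ c := by positivity
  have hδ : 0 < δ := by positivity
  have hδc : δ * c ≤ ε := by
    simp only [δ]
    rw [div_mul_eq_mul_div, div_le_iff₀ (by positivity)]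
    nlinarith
  -- The discretization needs strictly positive targets while `q x` may vanish; `δ` is small enough
  -- that its total effect over all symbols is at most `ε`.
  let v : {x // p x ≠ 0} → ℝ := fun x => q x ^ (1 - β) + δ
  have hqn : ∀ x, 0 ≤ q x ^ (1 - β) := fun x => Real.rpow_nonneg (hq.1 x) _
  have hv : ∀ x, 0 < v x := fun x => by have := hqn x; simp only [v]; linarith
  obtain ⟨t, k, ht, hk⟩ := exists_nat_discretization hβ hβ1
    (p := fun x : {x // p x ≠ 0} => p x) (fun x => (hp.1 x).lt_of_ne (Ne.symm x.2)) hv hε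
  obtain ⟨n, W, e, hW, hWe⟩ := exists_uniform_splitting hp ρ fun x => (hk x).1
  have hkpos : ∀ x, (0 : ℝ) < k x := fun x => by exact_mod_cast (hk x).1
  have hp0 : ∀ x : {x // p x ≠ 0}, 0 ≤ p x := fun x => hp.1 x
  have hm : ∀ i, classicalMarginal (markovEnsemble W p ρ) i = p (e i).1 * (k (e i).1 : ℝ)⁻¹ := by
    intro i
    rw [classicalMarginal, hWe, Matrix.trace_smul, (hN _).2]
    simp
  have hτ := postProcess_posSemidef hW (ensemble_posSemidef hp.1 hρ)
  rw [← markovEnsemble_eq_postProcess] at hτ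
  have htr : ∑ i, classicalMarginal (markovEnsemble W p ρ) i = 1 := by
    rw [markovEnsemble_eq_postProcess, sum_classicalMarginal_postProcess hW,
      classicalMarginal_ensemble p hρ, hp.2]
  have hsum : ∀ F : (Σ x : {x // p x ≠ 0}, Fin (k x)) → ℝ,
      ∑ i, F (e i) = ∑ x, ∑ j, F ⟨x, j⟩ := fun F => by
    rw [Equiv.sum_comp e F, Fintype.sum_sigma]
  refine absurd (lt_of_le_of_lt (le_iSup_of_le n (le_iSup₂_of_le W hW le_rfl)) hz)
    (not_lt.2 (le_arimotoInfo_of_family h1 hτ htr (K := t * (1 + ε)) (by positivity) ?_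
      (Ω := fun i => ((k (e i).1 : ℝ)⁻¹ * q (e i).1) • Ω (e i).1)
      (fun i => (hΩ _).smul (mul_nonneg (inv_nonneg.2 (hkpos _).le) (hq.1 _))) ?_))
  · intro g hg
    simp only [hm]
    let G : (Σ x : {x // p x ≠ 0}, Fin (k x)) → ℝ := fun s => g (e.symm s)
    have hG0 : ∀ s, 0 ≤ G s := fun s => hg _
    have e1 : ∑ i, p (e i).1 * (k (e i).1 : ℝ)⁻¹ * g i ^ β =
        ∑ x : {x // p x ≠ 0}, ∑ j, p x * (k x : ℝ)⁻¹ * G ⟨x, j⟩ ^ β := by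
      rw [← hsum fun s => p s.1 * (k s.1 : ℝ)⁻¹ * G s ^ β]
      simp [G]
    have e2 : ∑ i, g i = ∑ x, ∑ j, G ⟨x, j⟩ := by
      rw [← hsum G]
      simp [G]
    rw [e1, e2]
    set T : {x // p x ≠ 0} → ℝ := fun x => ∑ j, G ⟨x, j⟩ with hT
    have hT0 : ∀ x, 0 ≤ T x := fun x => Finset.sum_nonneg fun j _ => hG0 _
    have hin : ∀ x : {x // p x ≠ 0}, ∑ j, p x * (k x : ℝ)⁻¹ * G ⟨x, j⟩ ^ β ≤ t * v x * T x ^ β := by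
      intro x
      have hki : (0 : ℝ) < (k x : ℝ)⁻¹ := inv_pos.2 (hkpos x)
      have hj := sum_rpow_mul_rpow_le hβ hβ1 (q := fun _ : Fin (k x) => (k x : ℝ)⁻¹)
        (g := fun j => G ⟨x, j⟩)
        ⟨fun _ => hki.le, by simp [(hkpos x).ne']⟩ (fun j => hG0 _)
      -- The power `1 - β` is the Hölder weight of the uniform distribution on the copies of `x`;
      -- the power `β` remains as the effective weight.
      have hkk : (k x : ℝ)⁻¹ = ((k x : ℝ)⁻¹) ^ β * ((k x : ℝ)⁻¹) ^ (1 - β) := by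
        rw [← Real.rpow_add hki, add_sub_cancel, Real.rpow_one]
      have h2 := mul_le_mul_of_nonneg_left hj
        (mul_nonneg (hp0 x) (Real.rpow_nonneg hki.le β))
      have h3 := mul_le_mul_of_nonneg_right (hk x).2.1 (Real.rpow_nonneg (hT0 x) β)
      refine le_trans (le_of_eq ?_) (h2.trans h3)
      rw [Finset.mul_sum]
      refine Finset.sum_congr rfl fun j _ => ?_
      calc p x * (k x : ℝ)⁻¹ * G ⟨x, j⟩ ^ β
          = p x * (((k x : ℝ)⁻¹) ^ β * ((k x : ℝ)⁻¹) ^ (1 - β)) * G ⟨x, j⟩ ^ β := by rw [← hkk]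
        _ = _ := by ring
    refine (Finset.sum_le_sum fun x _ => hin x).trans ?_
    have hST : ∀ x, T x ≤ ∑ y, T y := fun x =>
      Finset.single_le_sum (fun y _ => hT0 y) (Finset.mem_univ x)
    have h4 : ∑ x, T x ^ β ≤ c * (∑ x, T x) ^ β := by
      have := Finset.sum_le_sum fun x (_ : x ∈ Finset.univ) =>
        Real.rpow_le_rpow (hT0 x) (hST x) hβ.le
      simpa [hc] using this
    have h5 := sum_rpow_mul_rpow_le hβ hβ1 hq hT0
    have h6 : ∑ x, t * v x * T x ^ β = t * (∑ x, q x ^ (1 - β) * T x ^ β + δ * ∑ x, T x ^ β) := by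
      rw [Finset.mul_sum, ← Finset.sum_add_distrib, Finset.mul_sum]
      exact Finset.sum_congr rfl fun x _ => by simp only [v]; ring
    rw [h6, mul_assoc]
    refine mul_le_mul_of_nonneg_left ?_ ht.le
    have h7 := mul_le_mul_of_nonneg_left h4 hδ.le
    have h8 := mul_le_mul_of_nonneg_right hδc
      (Real.rpow_nonneg (Finset.sum_nonneg fun x (_ : x ∈ Finset.univ) => hT0 x) β)
    linarith
  · intro σ hσ
    have e1 : ∑ i, trPair σ (((k (e i).1 : ℝ)⁻¹ * q (e i).1) • Ω (e i).1) =
        ∑ x, q x * trPair σ (Ω x) := by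
      rw [hsum fun s => trPair σ (((k s.1 : ℝ)⁻¹ * q s.1) • Ω s.1)]
      refine Finset.sum_congr rfl fun x _ => ?_
      simp only [trPair_smul, Finset.sum_const, Finset.card_univ, Fintype.card_fin, nsmul_eq_mul]
      have := (hkpos x).ne'
      field_simp
    have e2 : ∑ i, trPair (markovEnsemble W p ρ i)
          (cfc (phi β) (((k (e i).1 : ℝ)⁻¹ * q (e i).1) • Ω (e i).1)) =
        ∑ x : {x // p x ≠ 0}, p x * ((k x : ℝ)⁻¹) ^ β * (q x ^ β * trPair (N x) (cfc (phi β) (Ω x))) := by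
      simp only [hWe]
      rw [hsum fun s => trPair ((p s.1 * (k s.1 : ℝ)⁻¹) • N s.1)
        (cfc (phi β) (((k s.1 : ℝ)⁻¹ * q s.1) • Ω s.1))]
      refine Finset.sum_congr rfl fun x _ => ?_
      have hki : (0 : ℝ) ≤ (k x : ℝ)⁻¹ := (inv_pos.2 (hkpos x)).le
      simp only [cfc_phi_smul_of_ne h0 (hΩ x) (mul_nonneg hki (hq.1 x)), trPair_smul,
        trPair_smul_left, Finset.sum_const, Finset.card_univ, Fintype.card_fin, nsmul_eq_mul,
        Real.mul_rpow hki (hq.1 x)]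
      have := (hkpos x).ne'
      field_simp
    rw [e1, e2]
    have hterm : ∀ x, t * (q x * trPair (N x) (cfc (phi β) (Ω x))) ≤
        (1 + ε) * (p x * ((k x : ℝ)⁻¹) ^ β * (q x ^ β * trPair (N x) (cfc (phi β) (Ω x)))) := by
      intro x
      have hT0 : 0 ≤ q x ^ β * trPair (N x) (cfc (phi β) (Ω x)) :=
        mul_nonneg (Real.rpow_nonneg (hq.1 x) _) (trPair_cfc_phi_nonneg h0 (hN x).1 (hΩ x))
      have h2 := mul_le_mul_of_nonneg_right (hk x).2.2 hT0
      have hqq : q x ^ (1 - β) * q x ^ β = q x := by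
        rcases (hq.1 x).eq_or_lt with hx | hx
        · rw [← hx, Real.zero_rpow h0, mul_zero]
        · rw [← Real.rpow_add hx, sub_add_cancel, Real.rpow_one]
      have h3 : q x * trPair (N x) (cfc (phi β) (Ω x)) ≤
          v x * (q x ^ β * trPair (N x) (cfc (phi β) (Ω x))) := by
        have h4 := mul_nonneg hδ.le hT0
        calc q x * trPair (N x) (cfc (phi β) (Ω x))
            = (q x ^ (1 - β) * q x ^ β) * trPair (N x) (cfc (phi β) (Ω x)) := by rw [hqq]
          _ ≤ _ := by simp only [v]; linarith
      have h4 := mul_le_mul_of_nonneg_left h3 ht.le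
      linarith
    have hs := Finset.sum_le_sum fun x (_ : x ∈ Finset.univ) => hterm x
    rw [← Finset.mul_sum, ← Finset.mul_sum] at hs
    have hσΩ : 0 ≤ (∑ x, q x * trPair σ (Ω x)) ^ β := Real.rpow_nonneg
      (Finset.sum_nonneg fun x _ => mul_nonneg (hq.1 x) (trPair_nonneg hσ.1 (hΩ x))) _
    have h5 := mul_lt_mul_of_pos_left
      ((mul_le_mul_of_nonneg_right hεz hσΩ).trans_lt (h σ hσ)) ht
    have h6 := h5.trans_le hs
    refine lt_of_mul_lt_mul_left (lt_of_eq_of_lt ?_ h6) (show (0 : ℝ) ≤ 1 + ε by positivity)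
    ring

end Markov

end QLeakage

/-! ### Assembly of the theorem -/

theorem mainTheorem3 {X B : Type*} [Fintype X] [DecidableEq X] [Fintype B] [DecidableEq B]
    (p : X → ℝ) (hp : p ∈ stdSimplex ℝ X)
    (ρ : X → Matrix B B ℂ) (hρ : ∀ x, IsDensity (ρ x)) (α : ℝ≥0∞) :
    (1 < α →
      maxLeakage α p ρ = maxArimotoInfo α p ρ ∧
      maxArimotoInfo α p ρ = measuredCapacity α (restrictSupp p ρ) ∧
      measuredCapacity α (restrictSupp p ρ) = arimotoCapacity α (restrictSupp p ρ) ∧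
      arimotoCapacity α (restrictSupp p ρ) = divergenceRadius α (restrictSupp p ρ)) ∧
    (α = 1 →
      maxLeakage 1 p ρ = maxArimotoInfo 1 p ρ ∧
      maxArimotoInfo 1 p ρ = arimotoInfo 1 (ensemble p ρ)) := by
  constructor
  · intro h1
    have hB : Nonempty B := by
      have hτ : ∑ x, classicalMarginal (ensemble p ρ) x = 1 := by
        rw [classicalMarginal_ensemble p hρ, hp.2]
      exact (nonempty_of_sum_marginal hτ).2
    have hN : ∀ x, IsDensity (restrictSupp p ρ x) := fun x => hρ x
    have hC := measuredCapacity_eq_divergenceRadius h1 hN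
    have hA := arimotoCapacity_eq_divergenceRadius h1 hN
    have hM : maxArimotoInfo α p ρ = divergenceRadius α (restrictSupp p ρ) :=
      le_antisymm (maxArimotoInfo_le_divergenceRadius h1 hp hρ)
        (divergenceRadius_le_maxArimotoInfo h1 hp hρ)
    exact ⟨maxLeakage_eq_maxArimotoInfo h1.le hp hρ, hM.trans hC.symm, hC.trans hA.symm, hA⟩
  · intro _
    exact ⟨maxLeakage_eq_maxArimotoInfo le_rfl hp hρ, maxArimotoInfo_one_eq hp hρ⟩
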